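/- **Setting.** Let $q_0>0$, let $\mathbf q_+\in\mathbb C^2$ with $\|\mathbf q_+\|=q_0$, and put $w^{\perp}=(\bar w_2,-\bar w_1)^T$ for $w\in\mathbb C^2$. For $z\in\mathbb C\setminus\{0\}$ let $k=\tfrac12(z-q_0^2/z)$, $\lambda=\tfrac12(z+q_0^2/z)$, $\theta_1=\lambda[x+2(2k^2-q_0^2)t]$, $\theta_2=k(x+4k^2t)$, $\Theta=\mathrm{diag}(\theta_1,\theta_2,-\theta_1)$. Let $\Sigma=\mathbb R\cup\{|z|=q_0\}$; let $D_1,D_2$ be the parts of $\{|z|>q_0\}$ in the upper and lower half plane, $D_3,D_4$ the parts of $\{|z|<q_0\}$ in the lower and upper half plane, $D_+=D_1\cup D_3$, $D_-=D_2\cup D_4$, and orient $\Sigma$ so that $D_+$ lies on its left. Write $\hat\tau=-q_0^2/\tau$. Let $z_n\ (1\le n\le N_1)$, $\zeta_n\ (1\le n\le N_2)$, $\omega_n\ (1\le n\le N_3)$ be pairwise distinct points of $D_1$, let $E_n,\widehat E_n,\check E_n,\widetilde E_n,F_n,\widehat F_n,\check F_n,\widetilde F_n,G_n,\widehat G_n,\check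 G_n,\widetilde G_n$ be complex constants, and let $L$ be a $3\times3$ matrix function on $\Sigma$. For every real $x,t$ let $M(x,t,\cdot)$ be a $3\times3$ matrix function with columns $m_1,m_2,m_3$ that solves the following Riemann–Hilbert problem (with $\widehat L=e^{i\Theta}Le^{-i\Theta}$): * $M$ is holomorphic off $\Sigma$ except for at most simple poles, which occur only in the columns and at the points listed below; it has boundary values $M^\pm$ from $D_\pm$ on $\Sigma\setminus\{0,\pm q_0,\pm iq_0\}$ with $M^+=M^-(I-\widehat L)$ there, and is bounded near $\pm q_0,\pm iq_0$; * off $\Sigma$, $M\to\begin{pmatrix}\mathbf q_+/q_0&\mathbf q_+^{\perp}/q_0&0\\0&0&1\end{pmatrix}$ as $z\to\infty$ and $zM\to\begin{pmatrix}0&0&i\mathbf q_+\\iq_0&0&0\end{pmatrix}$ as $z\to0$; * the residues of $m_1$ are $a_n m_3(z_n^*)$ at $z_n^*$, $b_n m_1(z_n)$ at $\hat z_n$, $c_n m_2(\zeta_n)$ at $\zeta_n$, $d_n m_2(\omega_n)$ at $\hat\omega_n$; those of $m_2$ are $e_n m_1(\zeta_n^*)$ at $\zeta_n^*$, $f_n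 m_1(\zeta_n^*)$ at $\widehat{\zeta_n^*}$, $g_n m_3(\omega_n^*)$ at $\omega_n^*$, $h_n m_3(\omega_n^*)$ at $\widehat{\omega_n^*}$; those of $m_3$ are $\alpha_n m_1(z_n)$ at $z_n$, $\beta_n m_3(z_n^*)$ at $\widehat{z_n^*}$, $\gamma_n m_2(\zeta_n)$ at $\hat\zeta_n$, $\delta_n m_2(\omega_n)$ at $\omega_n$, where $$a_n=\widehat E_ne^{-2i\theta_1(z_n^*)},\quad b_n=\tfrac{z_n}{iq_0}\widetilde E_ne^{-2i\theta_1(\hat z_n)},\quad c_n=F_ne^{i(\theta_2-\theta_1)(\zeta_n)},\quad d_n=\widetilde G_ne^{i(\theta_2-\theta_1)(\hat\omega_n)},$$ $$e_n=\widehat F_ne^{i(\theta_1-\theta_2)(\zeta_n^*)},\quad f_n=\tfrac{\zeta_n^*}{iq_0}\check F_ne^{-i(\theta_1+\theta_2)(\widehat{\zeta_n^*})},\quad g_n=\widehat G_ne^{-i(\theta_1+\theta_2)(\omega_n^*)},\quad h_n=\tfrac{\omega_n^*}{iq_0}\check G_ne^{i(\theta_1-\theta_2)(\widehat{\omega_n^*})},$$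 $$\alpha_n=E_ne^{2i\theta_1(z_n)},\quad \beta_n=\tfrac{z_n^*}{iq_0}\check E_ne^{2i\theta_1(\widehat{z_n^*})},\quad \gamma_n=\widetilde F_ne^{i(\theta_1+\theta_2)(\hat\zeta_n)},\quad \delta_n=G_ne^{i(\theta_1+\theta_2)(\omega_n)}.$$ Let $\mathbf q(x,t)\in\mathbb C^2$, continuous in $x$, be the potential of $M$: for $z$ off $\Sigma$ and off the poles, $\Phi=Me^{i\Theta}$ satisfies $\Phi_x=(ik\sigma_3+Q)\Phi$ with $\sigma_3=\mathrm{diag}(1,1,-1)$ and $Q=\begin{pmatrix}0&\mathbf q\\-\mathbf q^\dagger&0\end{pmatrix}$. **Theorem.** Write $m_{jc}$ for the $(j,c)$ entry of $M$; let $j\in\{1,2\}$ and $x,t\in\mathbb R$. (1) If $(M^-\widehat L)_{j3}$ is absolutely integrable along $\Sigma$, then $$q_j=q_{+,j}-i\sum_{n=1}^{N_1}\alpha_n m_{j1}(z_n)-i\sum_{n=1}^{N_1}\beta_n m_{j3}(z_n^*)-i\sum_{n=1}^{N_2}\gamma_n m_{j2}(\zeta_n)-i\sum_{n=1}^{N_3}\delta_n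 m_{j2}(\omega_n)-\frac1{2\pi}\int_\Sigma(M^-\widehat L)_{j3}(\xi)\,d\xi .$$ (2) Let $L=0$ on $\Sigma$ (the reflectionless case). Then the formula of (1) holds without the integral. Put $$\Delta^{(1)}_n(w)=\tfrac{e_n}{w-\zeta_n^*}+\tfrac{f_n}{w-\widehat{\zeta_n^*}},\ \Delta^{(2)}_n(w)=\tfrac{g_n}{w-\omega_n^*}+\tfrac{h_n}{w-\widehat{\omega_n^*}},\ \Delta^{(3)}_n(w)=\tfrac{b_n}{w-\hat z_n},\ \Delta^{(4)}_n(w)=\tfrac{a_n}{w-z_n^*},\ \Delta^{(5)}_n(w)=\tfrac{c_n}{w-\zeta_n},$$ $$\Delta^{(6)}_n(w)=\tfrac{d_n}{w-\hat\omega_n},\ \Delta^{(7)}_n(w)=\tfrac{\alpha_n}{w-z_n},\ \Delta^{(8)}_n(w)=\tfrac{\beta_n}{w-\widehat{z_n^*}},\ \Delta^{(9)}_n(w)=\tfrac{\gamma_n}{w-\hat\zeta_n},\ \Delta^{(10)}_n(w)=\tfrac{\delta_n}{w-\omega_n}.$$ Order $2N_1+N_2+N_3$ indices in four groups (of sizes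 $N_1,N_1,N_2,N_3$), let $R_1(w)$ be the row vector with entries $(\Delta^{(3)}_n(w)),(\Delta^{(4)}_n(w)),(\Delta^{(5)}_n(w)),(\Delta^{(6)}_n(w))$ in these groups, $R_3(w)$ the one with entries $(\Delta^{(7)}_n(w)),\dots,(\Delta^{(10)}_n(w))$, and $R_2(w)=\sum_{n\le N_2}\Delta^{(1)}_n(w)R_1(\zeta_n^*)+\sum_{n\le N_3}\Delta^{(2)}_n(w)R_3(\omega_n^*)$. Let $F$ be the matrix with rows $R_1(z_n)$, $R_3(z_n^*)$, $R_2(\zeta_n)$, $R_2(\omega_n)$, and $W=I-F$. Let $\mathbf x$ have entries $m_{j1}(z_n)$, $m_{j3}(z_n^*)$, $m_{j2}(\zeta_n)$, $m_{j2}(\omega_n)$, let $\mathbf y$ have entries $i\alpha_n,i\beta_n,i\gamma_n,i\delta_n$, and let $\mathbf b$ have entries $q_{+,j}/q_0$, $\ iq_{+,j}/z_n^*$, $\ B(\zeta_n)$, $\ B(\omega_n)$, where $$B(w)=\frac{(\mathbf q_+^\perp)_j}{q_0}+\sum_{n\le N_2}\Delta^{(1)}_n(w)\frac{q_{+,j}}{q_0}+\sum_{n\le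 N_3}\Delta^{(2)}_n(w)\frac{iq_{+,j}}{\omega_n^*}.$$ Then $W\mathbf x=\mathbf b$ and, with $W^{aug}=\begin{pmatrix}q_{+,j}&\mathbf y^T\\ \mathbf b&W\end{pmatrix}$, $\det W\cdot q_j(x,t)=\det W^{aug}$. If $\det W\ne0$, then $\mathbf x_k=\det W_k^{aug}/\det W$ for every $k$, where $W_k^{aug}$ is $W$ with its $k$-th column replaced by $\mathbf b$, and $$q_j(x,t)=\frac{\det W^{aug}}{\det W}.$$ -/

import Mathlib

open Complex Matrix Filter Topology MeasureTheory
open scoped ComplexConjugate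

namespace CMKdV

noncomputable section

/-! ### Spectral variables, phases and the scattering problem -/

/-- `k = (z - q₀² / z) / 2`, as a function of the uniformization variable `z = k + λ`. -/
def kOf (q0 : ℝ) (z : ℂ) : ℂ := (z - (q0 : ℂ) ^ 2 / z) / 2

/-- `λ = (z + q₀² / z) / 2`, so that `λ² = k² + q₀²`. -/
def lamOf (q0 : ℝ) (z : ℂ) : ℂ := (z + (q0 : ℂ) ^ 2 / z) / 2

/-- `θ₁(x,t,z) = λ (x + 2 (2 k² - q₀²) t)`. -/
def theta1 (q0 x t : ℝ) (z : ℂ) : ℂ :=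
  lamOf q0 z * (x + 2 * (2 * kOf q0 z ^ 2 - (q0 : ℂ) ^ 2) * t)

/-- `θ₂(x,t,z) = k (x + 4 k² t)`. -/
def theta2 (q0 x t : ℝ) (z : ℂ) : ℂ :=
  kOf q0 z * (x + 4 * kOf q0 z ^ 2 * t)

/-- The matrix `e^{iΘ}` with `Θ = diag(θ₁, θ₂, -θ₁)`. -/
def expPhase (q0 x t : ℝ) (z : ℂ) : Matrix (Fin 3) (Fin 3) ℂ :=
  Matrix.diagonal ![exp (I * theta1 q0 x t z), exp (I * theta2 q0 x t z),
    exp (-(I * theta1 q0 x t z))]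

/-- The matrix `e^{-iΘ}`. -/
def expNegPhase (q0 x t : ℝ) (z : ℂ) : Matrix (Fin 3) (Fin 3) ℂ :=
  Matrix.diagonal ![exp (-(I * theta1 q0 x t z)), exp (-(I * theta2 q0 x t z)),
    exp (I * theta1 q0 x t z)]

/-- The orthogonal vector `w^⊥ = (w₂, -w₁)^†`. -/
def perp (w : Fin 2 → ℂ) : Fin 2 → ℂ := ![conj (w 1), -conj (w 0)]

/-- `σ₃ = diag(1, 1, -1)`. -/
def sigma3 : Matrix (Fin 3) (Fin 3) ℂ := Matrix.diagonal ![1, 1, -1]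

/-- The block matrix `Q = (0, q; -q^†, 0)` of a two-component potential value `w`. -/
def Qmat (w : Fin 2 → ℂ) : Matrix (Fin 3) (Fin 3) ℂ :=
  !![0, 0, w 0;
     0, 0, w 1;
     -conj (w 0), -conj (w 1), 0]

/-- The coefficient `U = i k σ₃ + Q` of the scattering problem `Φ_x = U Φ`. -/
def laxU (q0 : ℝ) (w : Fin 2 → ℂ) (z : ℂ) : Matrix (Fin 3) (Fin 3) ℂ :=
  (I * kOf q0 z) • sigma3 + Qmat w

/-! ### The contour and the four regions -/

def D1 (q0 : ℝ) : Set ℂ := {z | q0 < ‖z‖ ∧ 0 < z.im}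
def D2 (q0 : ℝ) : Set ℂ := {z | q0 < ‖z‖ ∧ z.im < 0}
def D3 (q0 : ℝ) : Set ℂ := {z | ‖z‖ < q0 ∧ z.im < 0}
def D4 (q0 : ℝ) : Set ℂ := {z | ‖z‖ < q0 ∧ 0 < z.im}

def Dplus (q0 : ℝ) : Set ℂ := D1 q0 ∪ D3 q0
def Dminus (q0 : ℝ) : Set ℂ := D2 q0 ∪ D4 q0

/-- The jump contour: the real line together with the circle of radius `q₀`. -/
def Sigma (q0 : ℝ) : Set ℂ := {z | z.im = 0 ∨ ‖z‖ = q0}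

/-- The point `q₀ e^{is}`. -/
def circPt (q0 s : ℝ) : ℂ := q0 * exp (I * s)

/-- Absolute integrability along `Σ`. -/
def SigmaIntegrable (q0 : ℝ) (f : ℂ → ℂ) : Prop :=
  Integrable (fun s : ℝ => f s) ∧
    IntervalIntegrable (fun s : ℝ => f (circPt q0 s)) volume 0 (2 * Real.pi)

/-- The integral `∫_Σ f(ξ) dξ`, where `Σ` is oriented so that `D₁ ∪ D₃` lies on its left:
left to right on `|ξ| > q₀`, right to left on `(-q₀, q₀)`, counterclockwise on the lower
semicircle, clockwise on the upper one. -/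
def sigmaIntegral (q0 : ℝ) (f : ℂ → ℂ) : ℂ :=
  (∫ s in {s : ℝ | q0 < |s|}, f s) - (∫ s in {s : ℝ | |s| < q0}, f s)
    + (∫ s in Real.pi..(2 * Real.pi), f (circPt q0 s) * (I * circPt q0 s))
    - (∫ s in (0 : ℝ)..Real.pi, f (circPt q0 s) * (I * circPt q0 s))

/-! ### Discrete data -/

/-- The involution `w ↦ -q₀² / w`. -/
def inv0 (q0 : ℝ) (w : ℂ) : ℂ := -((q0 : ℂ) ^ 2) / w

/-- Discrete eigenvalues of the first (`z`), second (`ζ`) and third (`ω`) type in `D₁`,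
pairwise distinct, with the residue constants at the four points of each quartet
`τ, τ*, -q₀²/τ*, -q₀²/τ` (in this order: plain, hat, check, tilde). -/
structure DiscreteData (q0 : ℝ) (N₁ N₂ N₃ : ℕ) where
  z : Fin N₁ → ℂ
  ζ : Fin N₂ → ℂ
  ω : Fin N₃ → ℂ
  z_mem : ∀ n, z n ∈ D1 q0
  ζ_mem : ∀ n, ζ n ∈ D1 q0
  ω_mem : ∀ n, ω n ∈ D1 q0
  distinct : Function.Injective (Sum.elim z (Sum.elim ζ ω))
  E : Fin N₁ → ℂ
  Ehat : Fin N₁ → ℂ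
  Echeck : Fin N₁ → ℂ
  Etilde : Fin N₁ → ℂ
  F : Fin N₂ → ℂ
  Fhat : Fin N₂ → ℂ
  Fcheck : Fin N₂ → ℂ
  Ftilde : Fin N₂ → ℂ
  G : Fin N₃ → ℂ
  Ghat : Fin N₃ → ℂ
  Gcheck : Fin N₃ → ℂ
  Gtilde : Fin N₃ → ℂ

namespace DiscreteData

variable {q0 : ℝ} {N₁ N₂ N₃ : ℕ} (S : DiscreteData q0 N₁ N₂ N₃)

/-- The poles of the `c`-th column. -/
def poles (c : Fin 3) : Set ℂ :=
  (![{w | (∃ n, w = conj (S.z n)) ∨ (∃ n, w = inv0 q0 (S.z n)) ∨ (∃ n, w = S.ζ n) ∨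
        (∃ n, w = inv0 q0 (S.ω n))},
     {w | (∃ n, w = conj (S.ζ n)) ∨ (∃ n, w = inv0 q0 (conj (S.ζ n))) ∨
        (∃ n, w = conj (S.ω n)) ∨ (∃ n, w = inv0 q0 (conj (S.ω n)))},
     {w | (∃ n, w = S.z n) ∨ (∃ n, w = inv0 q0 (conj (S.z n))) ∨
        (∃ n, w = inv0 q0 (S.ζ n)) ∨ (∃ n, w = S.ω n)}] : Fin 3 → Set ℂ) c

/-! The residue coefficients, with their exponential factors. -/

variable (x t : ℝ)

/-- `E_n e^{2iθ₁(z_n)}` -/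
def cE (n : Fin N₁) : ℂ := S.E n * exp (2 * I * theta1 q0 x t (S.z n))

/-- `Ê_n e^{-2iθ₁(z_n*)}` -/
def cEhat (n : Fin N₁) : ℂ := S.Ehat n * exp (-(2 * I * theta1 q0 x t (conj (S.z n))))

/-- `(z_n* / (i q₀)) Ě_n e^{2iθ₁(-q₀²/z_n*)}` -/
def cEcheck (n : Fin N₁) : ℂ :=
  conj (S.z n) / (I * q0) * S.Echeck n
    * exp (2 * I * theta1 q0 x t (inv0 q0 (conj (S.z n))))

/-- `(z_n / (i q₀)) Ẽ_n e^{-2iθ₁(-q₀²/z_n)}` -/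
def cEtilde (n : Fin N₁) : ℂ :=
  S.z n / (I * q0) * S.Etilde n * exp (-(2 * I * theta1 q0 x t (inv0 q0 (S.z n))))

/-- `F_n e^{i(θ₂-θ₁)(ζ_n)}` -/
def cF (n : Fin N₂) : ℂ :=
  S.F n * exp (I * (theta2 q0 x t (S.ζ n) - theta1 q0 x t (S.ζ n)))

/-- `F̂_n e^{i(θ₁-θ₂)(ζ_n*)}` -/
def cFhat (n : Fin N₂) : ℂ :=
  S.Fhat n * exp (I * (theta1 q0 x t (conj (S.ζ n)) - theta2 q0 x t (conj (S.ζ n))))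

/-- `(ζ_n* / (i q₀)) F̌_n e^{-i(θ₁+θ₂)(-q₀²/ζ_n*)}` -/
def cFcheck (n : Fin N₂) : ℂ :=
  conj (S.ζ n) / (I * q0) * S.Fcheck n
    * exp (-(I * (theta1 q0 x t (inv0 q0 (conj (S.ζ n)))
        + theta2 q0 x t (inv0 q0 (conj (S.ζ n))))))

/-- `F̃_n e^{i(θ₁+θ₂)(-q₀²/ζ_n)}` -/
def cFtilde (n : Fin N₂) : ℂ :=
  S.Ftilde n
    * exp (I * (theta1 q0 x t (inv0 q0 (S.ζ n)) + theta2 q0 x t (inv0 q0 (S.ζ n))))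

/-- `G_n e^{i(θ₁+θ₂)(ω_n)}` -/
def cG (n : Fin N₃) : ℂ :=
  S.G n * exp (I * (theta1 q0 x t (S.ω n) + theta2 q0 x t (S.ω n)))

/-- `Ĝ_n e^{-i(θ₁+θ₂)(ω_n*)}` -/
def cGhat (n : Fin N₃) : ℂ :=
  S.Ghat n * exp (-(I * (theta1 q0 x t (conj (S.ω n)) + theta2 q0 x t (conj (S.ω n)))))

/-- `(ω_n* / (i q₀)) Ǧ_n e^{i(θ₁-θ₂)(-q₀²/ω_n*)}` -/
def cGcheck (n : Fin N₃) : ℂ :=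
  conj (S.ω n) / (I * q0) * S.Gcheck n
    * exp (I * (theta1 q0 x t (inv0 q0 (conj (S.ω n)))
        - theta2 q0 x t (inv0 q0 (conj (S.ω n)))))

/-- `G̃_n e^{i(θ₂-θ₁)(-q₀²/ω_n)}` -/
def cGtilde (n : Fin N₃) : ℂ :=
  S.Gtilde n
    * exp (I * (theta2 q0 x t (inv0 q0 (S.ω n)) - theta1 q0 x t (inv0 q0 (S.ω n))))

end DiscreteData

/-! ### The Riemann-Hilbert problem -/

/-- The `c`-th column of `M` has at `τ` an (at most) simple pole with residue vector `v`. -/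
def HasColResidue (M : ℂ → Matrix (Fin 3) (Fin 3) ℂ) (τ : ℂ) (c : Fin 3)
    (v : Fin 3 → ℂ) : Prop :=
  ∀ r, Tendsto (fun w => (w - τ) * M w r c) (𝓝[≠] τ) (𝓝 (v r))

/-- The value of `M` at infinity. -/
def Minf (q0 : ℝ) (qp : Fin 2 → ℂ) : Matrix (Fin 3) (Fin 3) ℂ :=
  !![qp 0 / q0, perp qp 0 / q0, 0;
     qp 1 / q0, perp qp 1 / q0, 0;
     0, 0, 1]

/-- The coefficient of `1 / z` in `M` at the origin. -/
def Mzero (q0 : ℝ) (qp : Fin 2 → ℂ) : Matrix (Fin 3) (Fin 3) ℂ :=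
  !![0, 0, I * qp 0;
     0, 0, I * qp 1;
     I * q0, 0, 0]

/-- The conjugated jump datum `e^{iΘ} L e^{-iΘ}`. -/
def Lhat (q0 : ℝ) (L : ℂ → Matrix (Fin 3) (Fin 3) ℂ) (x t : ℝ) (ξ : ℂ) :
    Matrix (Fin 3) (Fin 3) ℂ :=
  expPhase q0 x t ξ * L ξ * expNegPhase q0 x t ξ

/-- `M`, with boundary values `Mp` (from `D₁ ∪ D₃`) and `Mm` (from `D₂ ∪ D₄`) on `Σ`, solves
at `(x,t)` the Riemann-Hilbert problem with jump matrix `1 - e^{iΘ} L e^{-iΘ}`. At the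
intersection points `±q₀` and the branch points `±i q₀` (the solutions of `ξ⁴ = q₀⁴`), only
boundedness is required. -/
structure IsRHSolution {q0 : ℝ} {N₁ N₂ N₃ : ℕ} (qp : Fin 2 → ℂ)
    (S : DiscreteData q0 N₁ N₂ N₃) (L : ℂ → Matrix (Fin 3) (Fin 3) ℂ) (x t : ℝ)
    (M Mp Mm : ℂ → Matrix (Fin 3) (Fin 3) ℂ) : Prop where
  holomorphic : ∀ r c, DifferentiableOn ℂ (fun w => M w r c) (Sigma q0 ∪ S.poles c)ᶜ
  boundary_plus : ∀ ξ ∈ Sigma q0, ξ ≠ 0 → ξ ^ 4 ≠ (q0 : ℂ) ^ 4 →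
    Tendsto M (𝓝[Dplus q0] ξ) (𝓝 (Mp ξ))
  boundary_minus : ∀ ξ ∈ Sigma q0, ξ ≠ 0 → ξ ^ 4 ≠ (q0 : ℂ) ^ 4 →
    Tendsto M (𝓝[Dminus q0] ξ) (𝓝 (Mm ξ))
  jump : ∀ ξ ∈ Sigma q0, ξ ≠ 0 → ξ ^ 4 ≠ (q0 : ℂ) ^ 4 →
    Mp ξ = Mm ξ * (1 - Lhat q0 L x t ξ)
  bounded_nodes : ∀ ξ : ℂ, ξ ^ 4 = (q0 : ℂ) ^ 4 → ∀ r c,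
    (fun w => M w r c) =O[𝓝[(Sigma q0)ᶜ] ξ] (fun _ => (1 : ℂ))
  at_infinity : Tendsto M (Bornology.cobounded ℂ ⊓ 𝓟 (Sigma q0)ᶜ) (𝓝 (Minf q0 qp))
  at_zero : Tendsto (fun w => w • M w) (𝓝[(Sigma q0)ᶜ] 0) (𝓝 (Mzero q0 qp))
  res_z : ∀ n, HasColResidue M (S.z n) 2 (fun r => S.cE x t n * M (S.z n) r 0)
  res_z_conj : ∀ n, HasColResidue M (conj (S.z n)) 0
    (fun r => S.cEhat x t n * M (conj (S.z n)) r 2)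
  res_z_inv_conj : ∀ n, HasColResidue M (inv0 q0 (conj (S.z n))) 2
    (fun r => S.cEcheck x t n * M (conj (S.z n)) r 2)
  res_z_inv : ∀ n, HasColResidue M (inv0 q0 (S.z n)) 0
    (fun r => S.cEtilde x t n * M (S.z n) r 0)
  res_ζ : ∀ n, HasColResidue M (S.ζ n) 0 (fun r => S.cF x t n * M (S.ζ n) r 1)
  res_ζ_conj : ∀ n, HasColResidue M (conj (S.ζ n)) 1
    (fun r => S.cFhat x t n * M (conj (S.ζ n)) r 0)
  res_ζ_inv_conj : ∀ n, HasColResidue M (inv0 q0 (conj (S.ζ n))) 1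
    (fun r => S.cFcheck x t n * M (conj (S.ζ n)) r 0)
  res_ζ_inv : ∀ n, HasColResidue M (inv0 q0 (S.ζ n)) 2
    (fun r => S.cFtilde x t n * M (S.ζ n) r 1)
  res_ω : ∀ n, HasColResidue M (S.ω n) 2 (fun r => S.cG x t n * M (S.ω n) r 1)
  res_ω_conj : ∀ n, HasColResidue M (conj (S.ω n)) 1
    (fun r => S.cGhat x t n * M (conj (S.ω n)) r 2)
  res_ω_inv_conj : ∀ n, HasColResidue M (inv0 q0 (conj (S.ω n))) 1
    (fun r => S.cGcheck x t n * M (conj (S.ω n)) r 2)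
  res_ω_inv : ∀ n, HasColResidue M (inv0 q0 (S.ω n)) 0
    (fun r => S.cGtilde x t n * M (S.ω n) r 1)

/-- `q` is the potential of `M`: away from the contour and the discrete spectrum, the columns
of `Φ = M e^{iΘ}` solve the scattering problem `Φ_x = (i k σ₃ + Q) Φ`. -/
def IsPotentialOf {q0 : ℝ} {N₁ N₂ N₃ : ℕ} (S : DiscreteData q0 N₁ N₂ N₃)
    (M : ℝ → ℝ → ℂ → Matrix (Fin 3) (Fin 3) ℂ) (q : ℝ → ℝ → Fin 2 → ℂ) : Prop :=
  ∀ t : ℝ, ∀ w : ℂ, w ∉ Sigma q0 → (∀ c, w ∉ S.poles c) → ∀ (x : ℝ) (r c : Fin 3),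
    HasDerivAt (fun x' : ℝ => (M x' t w * expPhase q0 x' t w) r c)
      ((laxU q0 (q x t) w * (M x t w * expPhase q0 x t w)) r c) x

/-! ### The linear system of the reflectionless case -/

/-- Indices of the unknowns: `z_n`, `z_n*`, `ζ_n`, `ω_n`. -/
abbrev Idx (N₁ N₂ N₃ : ℕ) : Type := Fin N₁ ⊕ Fin N₁ ⊕ Fin N₂ ⊕ Fin N₃

namespace DiscreteData

variable {q0 : ℝ} {N₁ N₂ N₃ : ℕ} (S : DiscreteData q0 N₁ N₂ N₃) (x t : ℝ)

/-- The sum of the residues of the `j`-th entry of the third column of `M`. -/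
def residueSum (M : ℂ → Matrix (Fin 3) (Fin 3) ℂ) (j : Fin 2) : ℂ :=
  (∑ n, S.cE x t n * M (S.z n) j.castSucc 0)
    + (∑ n, S.cEcheck x t n * M (conj (S.z n)) j.castSucc 2)
    + (∑ n, S.cFtilde x t n * M (S.ζ n) j.castSucc 1)
    + (∑ n, S.cG x t n * M (S.ω n) j.castSucc 1)

/-- The vector of unknowns in the `j`-th row of `M`. -/
def unknowns (M : ℂ → Matrix (Fin 3) (Fin 3) ℂ) (j : Fin 2) : Idx N₁ N₂ N₃ → ℂ :=
  Sum.elim (fun n => M (S.z n) j.castSucc 0)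
    (Sum.elim (fun n => M (conj (S.z n)) j.castSucc 2)
      (Sum.elim (fun n => M (S.ζ n) j.castSucc 1) (fun n => M (S.ω n) j.castSucc 1)))

def Δ1 (n : Fin N₂) (w : ℂ) : ℂ :=
  S.cFhat x t n / (w - conj (S.ζ n)) + S.cFcheck x t n / (w - inv0 q0 (conj (S.ζ n)))
def Δ2 (n : Fin N₃) (w : ℂ) : ℂ :=
  S.cGhat x t n / (w - conj (S.ω n)) + S.cGcheck x t n / (w - inv0 q0 (conj (S.ω n)))
def Δ3 (n : Fin N₁) (w : ℂ) : ℂ := S.cEtilde x t n / (w - inv0 q0 (S.z n))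
def Δ4 (n : Fin N₁) (w : ℂ) : ℂ := S.cEhat x t n / (w - conj (S.z n))
def Δ5 (n : Fin N₂) (w : ℂ) : ℂ := S.cF x t n / (w - S.ζ n)
def Δ6 (n : Fin N₃) (w : ℂ) : ℂ := S.cGtilde x t n / (w - inv0 q0 (S.ω n))
def Δ7 (n : Fin N₁) (w : ℂ) : ℂ := S.cE x t n / (w - S.z n)
def Δ8 (n : Fin N₁) (w : ℂ) : ℂ := S.cEcheck x t n / (w - inv0 q0 (conj (S.z n)))
def Δ9 (n : Fin N₂) (w : ℂ) : ℂ := S.cFtilde x t n / (w - inv0 q0 (S.ζ n))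
def Δ10 (n : Fin N₃) (w : ℂ) : ℂ := S.cG x t n / (w - S.ω n)

/-- Row of `F` that expresses a first-column entry at `w`. -/
def row1 (w : ℂ) : Idx N₁ N₂ N₃ → ℂ :=
  Sum.elim (fun n => S.Δ3 x t n w) (Sum.elim (fun n => S.Δ4 x t n w)
    (Sum.elim (fun n => S.Δ5 x t n w) (fun n => S.Δ6 x t n w)))

/-- Row of `F` that expresses a third-column entry at `w`. -/
def row3 (w : ℂ) : Idx N₁ N₂ N₃ → ℂ :=
  Sum.elim (fun n => S.Δ7 x t n w) (Sum.elim (fun n => S.Δ8 x t n w)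
    (Sum.elim (fun n => S.Δ9 x t n w) (fun n => S.Δ10 x t n w)))

/-- Row of `F` that expresses a second-column entry at `w`, after elimination of the
first-column entries at `ζ_n*` and of the third-column entries at `ω_n*`. -/
def row2 (w : ℂ) (i : Idx N₁ N₂ N₃) : ℂ :=
  (∑ n, S.Δ1 x t n w * S.row1 x t (conj (S.ζ n)) i)
    + ∑ n, S.Δ2 x t n w * S.row3 x t (conj (S.ω n)) i

def Fmat : Matrix (Idx N₁ N₂ N₃) (Idx N₁ N₂ N₃) ℂ :=
  Matrix.of (Sum.elim (fun n => S.row1 x t (S.z n))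
    (Sum.elim (fun n => S.row3 x t (conj (S.z n)))
      (Sum.elim (fun n => S.row2 x t (S.ζ n)) (fun n => S.row2 x t (S.ω n)))))

/-- `W = I - F`. -/
def W : Matrix (Idx N₁ N₂ N₃) (Idx N₁ N₂ N₃) ℂ := 1 - S.Fmat x t

/-- Inhomogeneous term of the eliminated second-column equation at `w`. -/
def b2 (qp : Fin 2 → ℂ) (j : Fin 2) (w : ℂ) : ℂ :=
  perp qp j / q0 + (∑ n, S.Δ1 x t n w * (qp j / q0))
    + ∑ n, S.Δ2 x t n w * (I * qp j / conj (S.ω n))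

def b (qp : Fin 2 → ℂ) (j : Fin 2) : Idx N₁ N₂ N₃ → ℂ :=
  Sum.elim (fun _ => qp j / q0)
    (Sum.elim (fun n => I * qp j / conj (S.z n))
      (Sum.elim (fun n => S.b2 x t qp j (S.ζ n)) (fun n => S.b2 x t qp j (S.ω n))))

def y : Idx N₁ N₂ N₃ → ℂ :=
  Sum.elim (fun n => I * S.cE x t n) (Sum.elim (fun n => I * S.cEcheck x t n)
    (Sum.elim (fun n => I * S.cFtilde x t n) (fun n => I * S.cG x t n)))

/-- `W^aug = (q₊, yᵀ; b, W)`, for the `j`-th component of the potential. -/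
def Waug (qp : Fin 2 → ℂ) (j : Fin 2) :
    Matrix (Unit ⊕ Idx N₁ N₂ N₃) (Unit ⊕ Idx N₁ N₂ N₃) ℂ :=
  Matrix.fromBlocks (Matrix.of fun _ _ => qp j) (Matrix.replicateRow Unit (S.y x t))
    (Matrix.replicateCol Unit (S.b x t qp j)) (S.W x t)

end DiscreteData

end

end CMKdV

/-! The third column of `M` is computed on the positive imaginary axis `z = iy` in two independent
ways, and the two values of the limit of `z m_{j3}(z)` as `y → ∞` are equated.

From the Riemann–Hilbert problem. Subtracting the principal parts at the simple poles
(`exists_differentiableOn_sub_polarPart`) leaves a function that is holomorphic off `Σ` and has the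
same jump. Cauchy's integral formula for such functions (`IsPiecewiseHolomorphic.eq_cauchy`)
expresses it through its value at infinity, its `1/z` term at the origin and the jump. Its expansion
at infinity gives the coefficient `i q_{+,j}` plus the residues plus the integral of `M⁻L̂` over
`2πi`. Cauchy's formula comes from `sigmaIntegral_jump`: each region becomes a half-strip under `ξ =
q₀ e^{±w}`, where Cauchy's theorem (`halfStrip_cauchy`) needs boundary limits only almost everywhere
on the side that maps to the circle, together with local boundedness.

From the scattering problem. At `z = iy` the equation for the third column damps its first two
entries at rate `y` and drives them by `q_j m_{33}`, while `m_{33} → 1`. Hence `y m_{j3} → q_j`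
(`tendsto_mul_of_damped_system`), and the limit is `i q_j`. Only pointwise limits of `M` in `x` are
available, so an energy estimate and a damping estimate on a short interval to the left of `x`
supply the missing uniformity.

If `L = 0` the Cauchy integral vanishes and every column is a rational function. Evaluating these at
the points where the residue conditions refer to them, and eliminating the auxiliary values of the
first and third columns, yields `W x = b`. Since `q_j = q_{+,j} - y · x`, the determinant formulas
are linear algebra (`det_bordered`, `det_updateCol_of_mulVec_eq`); the bordered identity needs a
solution of the system, not invertibility of `W`. -/

namespace CMKdV

/-! ### Cauchy's theorem on a half-strip with boundary values -/

/-- The open half-strip `{Re w > 0, a < Im w < b}`. -/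
def halfStrip (a b : ℝ) : Set ℂ := {w | 0 < w.re ∧ a < w.im ∧ w.im < b}

lemma closure_halfStrip {a b : ℝ} (hab : a < b) :
    closure (halfStrip a b) = Set.Ici 0 ×ℂ Set.Icc a b := by
  have : halfStrip a b = Set.Ioi 0 ×ℂ Set.Ioo a b := by
    ext w; simp [halfStrip, mem_reProdIm]
  rw [this, closure_reProdIm, closure_Ioi, closure_Ioo hab.ne]

/-- A function on the half-strip that is locally bounded up to the boundary is bounded on
bounded parts. -/
lemma exists_bound_halfStrip {a b : ℝ} {h : ℂ → ℂ}
    (hloc : ∀ w ∈ Set.Ici (0 : ℝ) ×ℂ Set.Icc a b, h =O[𝓝[halfStrip a b] w] (fun _ => (1 : ℂ)))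
    (R : ℝ) : ∃ C, ∀ w ∈ halfStrip a b, w.re ≤ R → ‖h w‖ ≤ C := by
  have hK : IsCompact (Set.Icc (0 : ℝ) R ×ℂ Set.Icc a b) := isCompact_Icc.reProdIm isCompact_Icc
  obtain ⟨C, hC⟩ := hK.induction_on (p := fun s => ∃ C, ∀ w ∈ s ∩ halfStrip a b, ‖h w‖ ≤ C)
    ⟨0, by simp⟩ (fun s t hst ⟨C, hC⟩ => ⟨C, fun w hw => hC w ⟨hst hw.1, hw.2⟩⟩)
    (fun s t ⟨C, hC⟩ ⟨C', hC'⟩ => ⟨max C C', by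
      rintro w ⟨hw | hw, hwS⟩
      · exact (hC w ⟨hw, hwS⟩).trans (le_max_left _ _)
      · exact (hC' w ⟨hw, hwS⟩).trans (le_max_right _ _)⟩)
    (fun w hw => by
      obtain ⟨C, hC⟩ := (hloc w ⟨hw.1.1, hw.2⟩).bound
      obtain ⟨u, hu, huC⟩ := mem_nhdsWithin_iff_exists_mem_nhds_inter.1 hC
      exact ⟨u, mem_nhdsWithin_of_mem_nhds hu, C, fun v hv => by simpa using huC hv⟩)
  exact ⟨C, fun w hw hR => hC w ⟨⟨⟨hw.1.le, hR⟩, hw.2.1.le, hw.2.2.le⟩, hw⟩⟩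

/-- Cauchy's theorem on rectangles `ε ≤ Re w ≤ R`, followed by `ε → 0` and `R → ∞`, both by
dominated convergence on the vertical sides. Only the difference of the two horizontal integrals has
to converge; each one alone may diverge. -/
theorem halfStrip_cauchy {a b : ℝ} (hab : a < b) {h : ℂ → ℂ} {hb ht hl : ℝ → ℂ} {A : ℂ}
    (hd : DifferentiableOn ℂ h (halfStrip a b))
    (hbt : ∀ s : ℝ, 0 < s → Tendsto h (𝓝[halfStrip a b] (s + a * I)) (𝓝 (hb s)))
    (htt : ∀ s : ℝ, 0 < s → Tendsto h (𝓝[halfStrip a b] (s + b * I)) (𝓝 (ht s)))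
    (hlt : ∀ᵐ y : ℝ, y ∈ Set.Ioo a b → Tendsto h (𝓝[halfStrip a b] (y * I)) (𝓝 (hl y)))
    (hbd : ∀ y ∈ Set.Icc a b, h =O[𝓝[halfStrip a b] (y * I)] (fun _ => (1 : ℂ)))
    (hinf : Tendsto h (comap re atTop ⊓ 𝓟 (halfStrip a b)) (𝓝 A)) :
    IntervalIntegrable hl volume a b ∧
    (∀ R > 0, IntervalIntegrable hb volume 0 R) ∧ (∀ R > 0, IntervalIntegrable ht volume 0 R) ∧
    Tendsto (fun R : ℝ => (∫ s in (0 : ℝ)..R, hb s) - ∫ s in (0 : ℝ)..R, ht s) atTop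
      (𝓝 (I * (∫ y in a..b, hl y) - I * ((b - a) * A))) := by
  set S := halfStrip a b with hS
  -- The extension is continuous up to the two horizontal sides. On the left side limits are known
  -- only almost everywhere, so that side is reached through `ε → 0`.
  set g := extendFrom S h with hg
  have hcl : closure S = Set.Ici 0 ×ℂ Set.Icc a b := closure_halfStrip hab
  have hcont : ContinuousOn h S := hd.continuousOn
  have hgS : ∀ w ∈ S, g w = h w := extendFrom_extends hcont
  have hex : ∀ w ∈ Set.Ioi (0 : ℝ) ×ℂ Set.Icc a b, ∃ v, Tendsto h (𝓝[S] w) (𝓝 v) := by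
    rintro w ⟨hw1, hw2, hw3⟩
    rcases hw2.lt_or_eq with h2 | h2
    · rcases hw3.lt_or_eq with h3 | h3
      · exact ⟨_, hcont w ⟨hw1, h2, h3⟩⟩
      · refine ⟨ht w.re, ?_⟩
        have := htt w.re hw1
        rwa [← h3, re_add_im] at this
    · refine ⟨hb w.re, ?_⟩
      have := hbt w.re hw1
      rwa [h2, re_add_im] at this
  have hsub : Set.Ioi (0 : ℝ) ×ℂ Set.Icc a b ⊆ closure S := by
    rw [hcl]; exact fun w hw => ⟨(show (0 : ℝ) < w.re from hw.1).le, hw.2⟩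
  have hgc : ContinuousOn g (Set.Ioi (0 : ℝ) ×ℂ Set.Icc a b) := continuousOn_extendFrom hsub hex
  have hgb : ∀ s : ℝ, 0 < s → g (s + a * I) = hb s := fun s hs =>
    extendFrom_eq (hsub (by simp [mem_reProdIm, hs, hab.le])) (hbt s hs)
  have hgt : ∀ s : ℝ, 0 < s → g (s + b * I) = ht s := fun s hs =>
    extendFrom_eq (hsub (by simp [mem_reProdIm, hs, hab.le])) (htt s hs)
  have hloc : ∀ w ∈ Set.Ici (0 : ℝ) ×ℂ Set.Icc a b, h =O[𝓝[S] w] (fun _ => (1 : ℂ)) := by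
    rintro w ⟨hw1, hw2⟩
    rcases (show (0 : ℝ) ≤ w.re from hw1).lt_or_eq with h1 | h1
    · obtain ⟨v, hv⟩ := hex w ⟨h1, hw2⟩
      exact hv.isBigO_one ℂ
    · have := hbd w.im hw2
      have h2 : (w.im * I : ℂ) = w := by
        apply Complex.ext <;> simp [← h1]
      rwa [h2] at this
  have hbound := exists_bound_halfStrip hloc
  -- bounds for the extension
  have hgbound : ∀ R, ∃ C, ∀ w ∈ Set.Ioc (0 : ℝ) R ×ℂ Set.Icc a b, ‖g w‖ ≤ C := by
    intro R
    -- The margin `1` is needed because `g w` is a limit of values of `h` at points whose real part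
    -- may exceed `R`.
    obtain ⟨C, hC⟩ := hbound (R + 1)
    refine ⟨C, fun w hw => ?_⟩
    have hwm : w ∈ Set.Ioi (0 : ℝ) ×ℂ Set.Icc a b := ⟨hw.1.1, hw.2⟩
    obtain ⟨v, hv⟩ := hex w hwm
    have : g w = v := extendFrom_eq (hsub hwm) hv
    rw [this]
    have : (𝓝[S] w).NeBot := mem_closure_iff_nhdsWithin_neBot.1 (hsub hwm)
    refine le_of_tendsto hv.norm ?_
    have h1 : ∀ᶠ v : ℂ in 𝓝[S] w, v.re < R + 1 :=
      (continuous_re.continuousAt.eventually (gt_mem_nhds (by linarith [hw.1.2]))).filter_mono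
        nhdsWithin_le_nhds
    filter_upwards [h1, self_mem_nhdsWithin] with v hv1 hv2 using hC v hv2 hv1.le
  have hline : ∀ c ∈ Set.Icc a b, ContinuousOn (fun s : ℝ => g (s + c * I)) (Set.Ioi 0) := by
    intro c hc
    refine hgc.comp (by fun_prop) fun s hs => ?_
    simpa [mem_reProdIm] using ⟨hs, hc⟩
  have hlineInt : ∀ c ∈ Set.Icc a b, ∀ R > 0,
      IntervalIntegrable (fun s : ℝ => g (s + c * I)) volume 0 R := by
    intro c hc R hR
    rw [intervalIntegrable_iff_integrableOn_Ioc_of_le hR.le]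
    obtain ⟨C, hC⟩ := hgbound R
    refine Integrable.of_bound
      (((hline c hc).mono (fun s hs => hs.1)).aestronglyMeasurable measurableSet_Ioc) C ?_
    filter_upwards [ae_restrict_mem measurableSet_Ioc] with s hs
    exact hC _ (by simpa [mem_reProdIm] using ⟨hs, hc⟩)
  have hcongr : ∀ c : ℝ, ∀ f : ℝ → ℂ, (∀ s : ℝ, 0 < s → g (s + c * I) = f s) → ∀ R > 0,
      Set.EqOn (fun s : ℝ => g (s + c * I)) f (Set.uIoc 0 R) := by
    intro c f hf R hR s hs
    rw [Set.uIoc_of_le hR.le] at hs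
    exact hf s hs.1
  have ham : a ∈ Set.Icc a b := ⟨le_rfl, hab.le⟩
  have hbm : b ∈ Set.Icc a b := ⟨hab.le, le_rfl⟩
  have hbi : ∀ R > 0, IntervalIntegrable hb volume 0 R := fun R hR =>
    (hlineInt a ham R hR).congr (hcongr a hb hgb R hR)
  have hti : ∀ R > 0, IntervalIntegrable ht volume 0 R := fun R hR =>
    (hlineInt b hbm R hR).congr (hcongr b ht hgt R hR)
  -- vertical segments
  have hvert : ∀ ε : ℝ, 0 < ε → ContinuousOn (fun y : ℝ => g (ε + y * I)) (Set.Icc a b) := by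
    intro ε hε
    refine hgc.comp (by fun_prop) fun y hy => ?_
    simpa [mem_reProdIm] using ⟨hε, hy⟩
  have hvm : ∀ ε : ℝ, 0 < ε → AEStronglyMeasurable (fun y : ℝ => g (ε + y * I))
      (volume.restrict (Set.uIoc a b)) := by
    intro ε hε
    rw [Set.uIoc_of_le hab.le]
    exact ((hvert ε hε).mono Set.Ioc_subset_Icc_self).aestronglyMeasurable measurableSet_Ioc
  obtain ⟨C, hC⟩ := hgbound 1
  have hC' : ∀ᶠ ε : ℝ in 𝓝[>] 0, ∀ᵐ y : ℝ, y ∈ Set.uIoc a b → ‖g (ε + y * I)‖ ≤ C := by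
    filter_upwards [Ioc_mem_nhdsGT (zero_lt_one)] with ε hε
    refine ae_of_all _ fun y hy => hC _ ?_
    rw [Set.uIoc_of_le hab.le] at hy
    simpa [mem_reProdIm] using ⟨hε, hy.1.le, hy.2⟩
  have hlim : ∀ᵐ y : ℝ, y ∈ Set.uIoc a b →
      Tendsto (fun ε : ℝ => g (ε + y * I)) (𝓝[>] 0) (𝓝 (hl y)) := by
    -- The half-open interval of integration contains the corner `b`, where no limit is assumed.
    have hne : ∀ᵐ y : ℝ, y ≠ b := by simp [ae_iff]
    filter_upwards [hlt, hne] with y hy hyb hym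
    rw [Set.uIoc_of_le hab.le] at hym
    have hy' : y ∈ Set.Ioo a b := ⟨hym.1, lt_of_le_of_ne hym.2 hyb⟩
    have h1 : ∀ᶠ ε : ℝ in 𝓝[>] 0, (ε + y * I : ℂ) ∈ S := by
      filter_upwards [self_mem_nhdsWithin] with ε hε
      simpa [hS, halfStrip] using ⟨hε, hy'⟩
    have h2 : Tendsto (fun ε : ℝ => (ε + y * I : ℂ)) (𝓝[>] 0) (𝓝[S] (y * I)) := by
      refine tendsto_nhdsWithin_iff.2 ⟨?_, h1⟩
      have : Continuous (fun ε : ℝ => (ε + y * I : ℂ)) := by fun_prop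
      have h3 := this.tendsto 0
      simp only [ofReal_zero, zero_add] at h3
      exact h3.mono_left nhdsWithin_le_nhds
    refine ((hy hy').comp h2).congr' ?_
    filter_upwards [h1] with ε hε using (hgS _ hε).symm
  have hli : IntervalIntegrable hl volume a b := by
    rw [Set.uIoc_of_le hab.le] at hlim hvm
    rw [intervalIntegrable_iff_integrableOn_Ioc_of_le hab.le]
    have hlim' : ∀ᵐ y : ℝ ∂(volume.restrict (Set.Ioc a b)),
        Tendsto (fun ε : ℝ => g (ε + y * I)) (𝓝[>] 0) (𝓝 (hl y)) :=
      (ae_restrict_iff' measurableSet_Ioc).2 hlim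
    -- Measurability of the left boundary value comes from a sequence of vertical sections
    -- converging to it.
    have hseq : Tendsto (fun n : ℕ => 1 / ((n : ℝ) + 1)) atTop (𝓝[>] 0) :=
      tendsto_nhdsWithin_iff.2 ⟨tendsto_one_div_add_atTop_nhds_zero_nat,
        Eventually.of_forall fun n => by simp only [Set.mem_Ioi]; positivity⟩
    refine Integrable.of_bound
      (aestronglyMeasurable_of_tendsto_ae atTop
        (f := fun (n : ℕ) (y : ℝ) => g ((1 / ((n : ℝ) + 1) : ℝ) + y * I))
        (fun n => hvm _ (by positivity)) ?_) C ?_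
    · filter_upwards [hlim'] with y hy using hy.comp hseq
    · filter_upwards [hlim', ae_restrict_mem measurableSet_Ioc] with y hy hym
      refine le_of_tendsto hy.norm ?_
      filter_upwards [Ioc_mem_nhdsGT (zero_lt_one)] with ε hε
      exact hC _ (by simpa [mem_reProdIm] using ⟨hε, hym.1.le, hym.2⟩)
  have hrect : ∀ ε R : ℝ, 0 < ε → 0 < R →
      (∫ s in ε..R, g (s + a * I)) - (∫ s in ε..R, g (s + b * I)) +
        I * (∫ y in a..b, g (R + y * I)) - I * (∫ y in a..b, g (ε + y * I)) = 0 := by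
    intro ε R hε hR
    have := integral_boundary_rect_eq_zero_of_continuousOn_of_differentiableOn g
      (ε + a * I) (R + b * I) ?_ ?_
    · simpa using this
    · refine hgc.mono fun w hw => ?_
      simp only [mem_reProdIm] at hw ⊢
      simp only [add_re, ofReal_re, mul_re, I_re, mul_zero, ofReal_im, I_im, mul_one, sub_self,
        add_zero, add_im, mul_im, zero_add, Set.uIcc_of_le hab.le] at hw
      exact ⟨lt_of_lt_of_le (lt_min hε hR) hw.1.1, hw.2⟩
    · suffices hsubS : ∀ w ∈ (Set.Ioo (min (ε + a * I : ℂ).re (R + b * I : ℂ).re)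
          (max (ε + a * I : ℂ).re (R + b * I : ℂ).re) ×ℂ
          Set.Ioo (min (ε + a * I : ℂ).im (R + b * I : ℂ).im)
          (max (ε + a * I : ℂ).im (R + b * I : ℂ).im)), w ∈ S from
        (hd.mono hsubS).congr fun w hw => hgS w (hsubS w hw)
      · intro w hw
        rw [mem_reProdIm] at hw
        simp only [add_re, ofReal_re, mul_re, I_re, mul_zero, ofReal_im, I_im, mul_one, sub_self,
          add_zero, add_im, mul_im, zero_add, min_eq_left hab.le, max_eq_right hab.le] at hw
        exact ⟨lt_trans (lt_min hε hR) hw.1.1, hw.2⟩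
  -- the limit of the left side
  have hrect0 : ∀ R : ℝ, 0 < R →
      (∫ s in (0 : ℝ)..R, hb s) - (∫ s in (0 : ℝ)..R, ht s) +
        I * (∫ y in a..b, g (R + y * I)) - I * (∫ y in a..b, hl y) = 0 := by
    intro R hR
    have hprim : ∀ c ∈ Set.Icc a b, Tendsto (fun ε => ∫ s in ε..R, g (s + c * I)) (𝓝[>] 0)
        (𝓝 (∫ s in (0 : ℝ)..R, g (s + c * I))) := by
      intro c hc
      have h1 : ContinuousOn (fun ε => ∫ s in R..ε, g (s + c * I)) (Set.uIcc 0 R) :=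
        intervalIntegral.continuousOn_primitive_interval' (hlineInt c hc R hR)
          Set.right_mem_uIcc
      have h2 := (h1 0 Set.left_mem_uIcc).neg
      rw [Set.uIcc_of_le hR.le] at h2
      rw [intervalIntegral.integral_symm R 0]
      refine (h2.tendsto.mono_left ?_).congr fun ε => (intervalIntegral.integral_symm _ _).symm
      exact nhdsWithin_le_of_mem (mem_of_superset (Ioc_mem_nhdsGT hR) Set.Ioc_subset_Icc_self)
    have hleft : Tendsto (fun ε : ℝ => ∫ y in a..b, g (ε + y * I)) (𝓝[>] 0)
        (𝓝 (∫ y in a..b, hl y)) :=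
      intervalIntegral.tendsto_integral_filter_of_dominated_convergence (fun _ => C)
        (by filter_upwards [self_mem_nhdsWithin] with ε hε using hvm ε hε) hC'
        intervalIntegrable_const hlim
    have hT := (((hprim a ham).sub (hprim b hbm)).add_const
      (I * (∫ y in a..b, g (R + y * I)))).sub (hleft.const_mul I)
    have h0 := tendsto_nhds_unique (hT.congr' (by
      filter_upwards [self_mem_nhdsWithin] with ε hε using hrect ε R hε hR)) tendsto_const_nhds
    rw [intervalIntegral.integral_congr_ae (ae_of_all _ fun s hs => hcongr a hb hgb R hR hs),
      intervalIntegral.integral_congr_ae (ae_of_all _ fun s hs => hcongr b ht hgt R hR hs)] at h0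
    exact h0
  -- the limit of the right side
  have hright : Tendsto (fun R : ℝ => ∫ y in a..b, g (R + y * I)) atTop (𝓝 ((b - a) * A)) := by
    have h1 : Tendsto (fun R : ℝ => ∫ y in a..b, g (R + y * I)) atTop
        (𝓝 (∫ y in a..b, A)) := by
      have hev : ∀ᶠ R : ℝ in atTop, ∀ w ∈ S, R ≤ w.re → ‖h w‖ ≤ ‖A‖ + 1 := by
        have := (hinf.norm).eventually (gt_mem_nhds (lt_add_one ‖A‖))
        rw [eventually_inf_principal, eventually_comap] at this
        obtain ⟨R₀, hR₀⟩ := eventually_atTop.1 this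
        filter_upwards [eventually_ge_atTop R₀] with R hR w hw hwR
        exact (hR₀ w.re (hR.trans hwR) w rfl hw).le
      have hmemS : ∀ R : ℝ, 0 < R → ∀ y ∈ Set.Ioo a b, (R + y * I : ℂ) ∈ S := by
        intro R hR y hy
        simpa [hS, halfStrip] using ⟨hR, hy⟩
      have hne : ∀ᵐ y : ℝ, y ≠ b := by simp [ae_iff]
      refine intervalIntegral.tendsto_integral_filter_of_dominated_convergence
        (fun _ => ‖A‖ + 1) ?_ ?_ intervalIntegrable_const ?_
      · filter_upwards [eventually_gt_atTop 0] with R hR using hvm R hR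
      · filter_upwards [eventually_gt_atTop 0, hev] with R hR hRA
        filter_upwards [hne] with y hyb hym
        rw [Set.uIoc_of_le hab.le] at hym
        have := hmemS R hR y ⟨hym.1, lt_of_le_of_ne hym.2 hyb⟩
        rw [hgS _ this]
        exact hRA _ this (by simp)
      · filter_upwards [hne] with y hyb hym
        rw [Set.uIoc_of_le hab.le] at hym
        have hm : ∀ᶠ R : ℝ in atTop, (R + y * I : ℂ) ∈ S := by
          filter_upwards [eventually_gt_atTop 0] with R hR
          exact hmemS R hR y ⟨hym.1, lt_of_le_of_ne hym.2 hyb⟩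
        have h2 : Tendsto (fun R : ℝ => (R + y * I : ℂ)) atTop (comap re atTop ⊓ 𝓟 S) := by
          refine tendsto_inf.2 ⟨tendsto_comap_iff.2 ?_, tendsto_principal.2 hm⟩
          exact tendsto_id.congr fun R => by simp
        refine (hinf.comp h2).congr' ?_
        filter_upwards [hm] with R hR using (hgS _ hR).symm
    simpa using h1
  refine ⟨hli, hbi, hti, ?_⟩
  have hT := ((tendsto_const_nhds (x := I * ∫ y in a..b, hl y)).sub (hright.const_mul I))
  refine hT.congr' ?_
  filter_upwards [eventually_gt_atTop 0] with R hR
  linear_combination -hrect0 R hR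

/-! ### Piecewise holomorphic functions with jump contour `Σ` -/

/-- `H` is holomorphic off `Σ`, has boundary values `Hp`, `Hm` on `Σ` away from the origin and
the four nodes, and is bounded near the nodes. -/
structure IsPiecewiseHolomorphic (q0 : ℝ) (H Hp Hm : ℂ → ℂ) : Prop where
  differentiableOn : DifferentiableOn ℂ H (Sigma q0)ᶜ
  plus : ∀ ξ ∈ Sigma q0, ξ ≠ 0 → ξ ^ 4 ≠ (q0 : ℂ) ^ 4 → Tendsto H (𝓝[Dplus q0] ξ) (𝓝 (Hp ξ))
  minus : ∀ ξ ∈ Sigma q0, ξ ≠ 0 → ξ ^ 4 ≠ (q0 : ℂ) ^ 4 → Tendsto H (𝓝[Dminus q0] ξ) (𝓝 (Hm ξ))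
  nodes : ∀ ξ : ℂ, ξ ^ 4 = (q0 : ℂ) ^ 4 → H =O[𝓝[(Sigma q0)ᶜ] ξ] (fun _ => (1 : ℂ))

lemma Dplus_subset (q0 : ℝ) : Dplus q0 ⊆ (Sigma q0)ᶜ := by
  rintro z (⟨h1, h2⟩ | ⟨h1, h2⟩) (h | h)
  exacts [h2.ne' h, h1.ne' h, h2.ne h, h1.ne h]

lemma Dminus_subset (q0 : ℝ) : Dminus q0 ⊆ (Sigma q0)ᶜ := by
  rintro z (⟨h1, h2⟩ | ⟨h1, h2⟩) (h | h)
  exacts [h2.ne h, h1.ne' h, h2.ne' h, h1.ne h]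

/-! ### Logarithmic coordinates on the four regions and the jump integral. -/

lemma norm_expMap {q0 : ℝ} (hq0 : 0 < q0) (κ : ℝ) (w : ℂ) :
    ‖(q0 * exp (κ * w) : ℂ)‖ = q0 * Real.exp (κ * w.re) := by
  simp [Complex.norm_exp, abs_of_pos hq0]

lemma im_expMap (q0 κ : ℝ) (w : ℂ) :
    (q0 * exp (κ * w) : ℂ).im = q0 * (Real.exp (κ * w.re) * Real.sin (κ * w.im)) := by
  simp [Complex.exp_im]

/-- Cauchy's theorem for one of the four regions, in the coordinate `w`, `ξ = q₀ e^{κ w}`. -/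
lemma region_cauchy {q0 : ℝ} (hq0 : 0 < q0) {κ a σ σ' : ℝ} (hκ : κ ≠ 0)
    (hσ : exp (κ * (a * I)) = σ) (hσ' : exp (κ * ((a + Real.pi : ℝ) * I)) = σ')
    (hσ2 : |σ| = 1) (hσ2' : |σ'| = 1)
    {D : Set ℂ} (hD : D ⊆ (Sigma q0)ᶜ)
    (hmap : ∀ w ∈ halfStrip a (a + Real.pi), (q0 * exp (κ * w) : ℂ) ∈ D)
    {H V : ℂ → ℂ} {C : ℂ} (hdiff : DifferentiableOn ℂ H (Sigma q0)ᶜ)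
    (hV : ∀ ξ ∈ Sigma q0, ξ ≠ 0 → ξ ^ 4 ≠ (q0 : ℂ) ^ 4 → Tendsto H (𝓝[D] ξ) (𝓝 (V ξ)))
    (hnodes : ∀ ξ : ℂ, ξ ^ 4 = (q0 : ℂ) ^ 4 → H =O[𝓝[(Sigma q0)ᶜ] ξ] (fun _ => (1 : ℂ)))
    (hC : Tendsto (fun w : ℂ => (q0 * exp (κ * w) : ℂ) * H (q0 * exp (κ * w)))
      (comap re atTop ⊓ 𝓟 (halfStrip a (a + Real.pi))) (𝓝 C)) :
    IntervalIntegrable (fun y : ℝ => circPt q0 (κ * y) * V (circPt q0 (κ * y))) volume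
      a (a + Real.pi) ∧
    (∀ R > 0, IntervalIntegrable (fun s : ℝ => ((σ * (q0 * Real.exp (κ * s)) : ℝ) : ℂ) *
      V ((σ * (q0 * Real.exp (κ * s)) : ℝ) : ℂ)) volume 0 R) ∧
    (∀ R > 0, IntervalIntegrable (fun s : ℝ => ((σ' * (q0 * Real.exp (κ * s)) : ℝ) : ℂ) *
      V ((σ' * (q0 * Real.exp (κ * s)) : ℝ) : ℂ)) volume 0 R) ∧
    Tendsto (fun R : ℝ =>
        (∫ s in (0 : ℝ)..R, ((σ * (q0 * Real.exp (κ * s)) : ℝ) : ℂ) *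
          V ((σ * (q0 * Real.exp (κ * s)) : ℝ) : ℂ)) -
        ∫ s in (0 : ℝ)..R, ((σ' * (q0 * Real.exp (κ * s)) : ℝ) : ℂ) *
          V ((σ' * (q0 * Real.exp (κ * s)) : ℝ) : ℂ)) atTop
      (𝓝 (I * (∫ y in a..(a + Real.pi), circPt q0 (κ * y) * V (circPt q0 (κ * y)))
        - I * (Real.pi * C))) := by
  set S := halfStrip a (a + Real.pi) with hS
  have hEc : Continuous (fun w : ℂ => (q0 * exp (κ * w) : ℂ)) := by fun_prop
  have hEt : ∀ w, Tendsto (fun w : ℂ => (q0 * exp (κ * w) : ℂ)) (𝓝[S] w)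
      (𝓝[D] (q0 * exp (κ * w))) := fun w =>
    tendsto_nhdsWithin_iff.2 ⟨(hEc.tendsto w).mono_left nhdsWithin_le_nhds,
      by filter_upwards [self_mem_nhdsWithin] with v hv using hmap v hv⟩
  have hlim : ∀ w, (q0 * exp (κ * w) : ℂ) ∈ Sigma q0 →
      (q0 * exp (κ * w) : ℂ) ^ 4 ≠ (q0 : ℂ) ^ 4 →
      Tendsto (fun w : ℂ => (q0 * exp (κ * w) : ℂ) * H (q0 * exp (κ * w))) (𝓝[S] w)
        (𝓝 ((q0 * exp (κ * w) : ℂ) * V (q0 * exp (κ * w)))) := fun w h1 h2 =>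
    ((hEc.tendsto w).mono_left nhdsWithin_le_nhds).mul
      ((hV _ h1 (mul_ne_zero (by exact_mod_cast hq0.ne') (exp_ne_zero _)) h2).comp (hEt w))
  have hray : ∀ (τ c : ℝ), |τ| = 1 → exp (κ * (c * I)) = τ → ∀ s : ℝ, 0 < s →
      Tendsto (fun w : ℂ => (q0 * exp (κ * w) : ℂ) * H (q0 * exp (κ * w))) (𝓝[S] (s + c * I))
        (𝓝 (((τ * (q0 * Real.exp (κ * s)) : ℝ) : ℂ) *
          V ((τ * (q0 * Real.exp (κ * s)) : ℝ) : ℂ))) := by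
    intro τ c hτ hc s hs
    have hval : (q0 * exp (κ * (s + c * I)) : ℂ) = ((τ * (q0 * Real.exp (κ * s)) : ℝ) : ℂ) := by
      rw [mul_add, Complex.exp_add, hc]; push_cast; ring
    -- For `s > 0` the modulus differs from `q₀`, so the ray contains no node.
    have h1 := hlim (s + c * I) (by rw [hval]; left; exact ofReal_im _) (by
      rw [hval]
      intro h
      have h2 : |τ * (q0 * Real.exp (κ * s))| ^ 4 = |q0| ^ 4 := by
        rw [← abs_pow, ← abs_pow]; congr 1; exact_mod_cast h
      rw [abs_mul, hτ, one_mul, abs_mul, Real.abs_exp, abs_of_pos hq0] at h2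
      have h3 := (pow_left_inj₀ (by positivity) hq0.le (by norm_num)).1 h2
      have h4 : Real.exp (κ * s) = 1 := mul_left_cancel₀ hq0.ne' (h3.trans (mul_one _).symm)
      exact mul_ne_zero hκ hs.ne' (Real.exp_eq_one_iff _ |>.1 h4))
    rwa [hval] at h1
  have hcirc : ∀ y : ℝ, (q0 * exp (κ * (y * I)) : ℂ) = circPt q0 (κ * y) := by
    intro y; simp only [circPt]; push_cast; ring_nf
  have hcircS : ∀ y : ℝ, circPt q0 y ∈ Sigma q0 := by
    intro y; right
    simp [circPt, Complex.norm_exp, abs_of_pos hq0]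
  -- The nodes correspond to `κ y ∈ (π/2)ℤ`, a countable set. There boundedness replaces the
  -- boundary limit.
  have hcount : ∀ᵐ y : ℝ, circPt q0 (κ * y) ^ 4 ≠ (q0 : ℂ) ^ 4 := by
    have : {y : ℝ | circPt q0 (κ * y) ^ 4 = (q0 : ℂ) ^ 4} ⊆
        Set.range (fun n : ℤ => n * (2 * Real.pi) / (4 * κ)) := by
      intro y hy
      have hq : (q0 : ℂ) ^ 4 ≠ 0 := pow_ne_zero _ (by exact_mod_cast hq0.ne')
      simp only [Set.mem_ofPred_eq, circPt, mul_pow] at hy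
      have h1 := mul_left_cancel₀ hq (hy.trans (mul_one _).symm)
      rw [← Complex.exp_nat_mul, Complex.exp_eq_one_iff] at h1
      obtain ⟨n, hn⟩ := h1
      refine ⟨n, ?_⟩
      have h2 : (4 * (κ * y) : ℂ) = n * (2 * Real.pi) := by
        apply mul_right_cancel₀ I_ne_zero
        push_cast at hn
        linear_combination hn
      have h3 : 4 * (κ * y) = n * (2 * Real.pi) := by exact_mod_cast h2
      field_simp
      linarith
    rw [ae_iff]
    simp only [not_not]
    exact ((Set.countable_range _).mono this).measure_zero _
  have hpi := Real.pi_pos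
  have := halfStrip_cauchy (a := a) (b := a + Real.pi) (by linarith)
    (h := fun w : ℂ => (q0 * exp (κ * w) : ℂ) * H (q0 * exp (κ * w)))
    (hl := fun y : ℝ => circPt q0 (κ * y) * V (circPt q0 (κ * y)))
    ?_ (hray σ a hσ2 hσ)
    (hray σ' (a + Real.pi) hσ2' hσ') ?_ ?_ hC
  · obtain ⟨h1, h2, h3, h4⟩ := this
    refine ⟨h1, h2, h3, ?_⟩
    simpa using h4
  · refine DifferentiableOn.mul (by fun_prop) (hdiff.comp (by fun_prop) fun w hw => ?_)
    exact hD (hmap w hw)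
  · filter_upwards [hcount] with y hy _
    have := hlim (y * I)
    rw [hcirc] at this
    exact this (hcircS _) hy
  · intro y _
    by_cases hy : circPt q0 (κ * y) ^ 4 = (q0 : ℂ) ^ 4
    · have h1 := hnodes _ hy
      have h2 : Tendsto (fun w : ℂ => (q0 * exp (κ * w) : ℂ)) (𝓝[S] (y * I))
          (𝓝[(Sigma q0)ᶜ] (circPt q0 (κ * y))) := by
        have := hEt (y * I)
        rw [hcirc] at this
        exact this.mono_right (nhdsWithin_mono _ hD)
      have h3 := h1.comp_tendsto h2
      have h4 : (fun w : ℂ => (q0 * exp (κ * w) : ℂ)) =O[𝓝[S] (y * I)] (fun _ => (1 : ℂ)) :=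
        ((hEc.tendsto _).mono_left nhdsWithin_le_nhds).isBigO_one ℂ
      simpa using h4.mul h3
    · have := hlim (y * I)
      rw [hcirc] at this
      exact (this (hcircS _) hy).isBigO_one ℂ

/-- Change of variables from a logarithmic coordinate to one of the four real rays. -/
lemma ray_integral {q0 : ℝ} (hq0 : 0 < q0) {κ σ : ℝ} (hκ : |κ| = 1) (hσ : |σ| = 1) {J : ℂ → ℂ}
    {T : Set ℝ} (hT : (fun s : ℝ => σ * (q0 * Real.exp (κ * s))) '' Set.Ioi 0 = T)
    (hJ : Integrable (fun s : ℝ => J s)) :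
    IntegrableOn (fun s : ℝ => (q0 * Real.exp (κ * s) : ℝ) *
      J ((σ * (q0 * Real.exp (κ * s)) : ℝ) : ℂ)) (Set.Ioi 0) ∧
    ∫ s in Set.Ioi (0 : ℝ), (q0 * Real.exp (κ * s) : ℝ) *
      J ((σ * (q0 * Real.exp (κ * s)) : ℝ) : ℂ) = ∫ s in T, J s := by
  have hd : ∀ s ∈ Set.Ioi (0 : ℝ), HasDerivWithinAt
      (fun s : ℝ => σ * (q0 * Real.exp (κ * s))) (σ * (q0 * (Real.exp (κ * s) * κ)))
      (Set.Ioi 0) s := by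
    intro s _
    have h1 : HasDerivAt (fun s : ℝ => κ * s) κ s := by
      simpa using (hasDerivAt_id s).const_mul κ
    exact ((h1.exp.const_mul q0).const_mul σ).hasDerivWithinAt
  have hκ0 : κ ≠ 0 := by rintro rfl; simp at hκ
  have hσ0 : σ ≠ 0 := by rintro rfl; simp at hσ
  have hinj : Set.InjOn (fun s : ℝ => σ * (q0 * Real.exp (κ * s))) (Set.Ioi 0) := by
    intro s _ t _ h
    have h1 := mul_left_cancel₀ hq0.ne' (mul_left_cancel₀ hσ0 h)
    exact mul_left_cancel₀ hκ0 (Real.exp_injective h1)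
  have habs : ∀ s : ℝ, |σ * (q0 * (Real.exp (κ * s) * κ))| = q0 * Real.exp (κ * s) := by
    intro s
    rw [abs_mul, abs_mul, abs_mul, hσ, hκ, Real.abs_exp, abs_of_pos hq0]; ring
  have h1 := integrableOn_image_iff_integrableOn_abs_deriv_smul measurableSet_Ioi hd hinj
    (fun s : ℝ => J s)
  have h2 := integral_image_eq_integral_abs_deriv_smul measurableSet_Ioi hd hinj
    (fun s : ℝ => J s)
  simp only [habs, real_smul] at h1 h2
  rw [hT] at h1 h2
  exact ⟨h1.1 hJ.integrableOn, h2.symm⟩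

/-- The strips `0 < Im w < π` and `π < Im w < 2π` are joined along their common rays, where `H⁺` and
`H⁻` combine into the jump. Each strip contributes `-iπC` from its far end. The sign of `κ` selects
the outside or the inside of the circle. -/
lemma two_regions_cauchy {q0 : ℝ} (hq0 : 0 < q0) {κ : ℝ} (hκ : |κ| = 1)
    {Dp Dm : Set ℂ} (hDp : Dp ⊆ Dplus q0) (hDm : Dm ⊆ Dminus q0)
    (hmapp : ∀ w ∈ halfStrip 0 (0 + Real.pi), (q0 * exp (κ * w) : ℂ) ∈ Dp)
    (hmapm : ∀ w ∈ halfStrip Real.pi (Real.pi + Real.pi), (q0 * exp (κ * w) : ℂ) ∈ Dm)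
    {H Hp Hm : ℂ → ℂ} {C : ℂ} (hH : IsPiecewiseHolomorphic q0 H Hp Hm)
    (hC : Tendsto (fun w : ℂ => (q0 * exp (κ * w) : ℂ) * H (q0 * exp (κ * w)))
      (comap re atTop ⊓ 𝓟 {w | (q0 * exp (κ * w) : ℂ) ∈ (Sigma q0)ᶜ}) (𝓝 C))
    {Tp Tm : Set ℝ} (hTp : (fun s : ℝ => 1 * (q0 * Real.exp (κ * s))) '' Set.Ioi 0 = Tp)
    (hTm : (fun s : ℝ => (-1) * (q0 * Real.exp (κ * s))) '' Set.Ioi 0 = Tm)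
    (hJ : Integrable (fun s : ℝ => Hp s - Hm s)) :
    IntervalIntegrable (fun y : ℝ => circPt q0 (κ * y) * Hp (circPt q0 (κ * y))) volume
      0 Real.pi ∧
    IntervalIntegrable (fun y : ℝ => circPt q0 (κ * y) * Hm (circPt q0 (κ * y))) volume
      Real.pi (2 * Real.pi) ∧
    (∫ s in Tp, (Hp s - Hm s)) + (∫ s in Tm, (Hp s - Hm s)) =
      I * (∫ y in (0 : ℝ)..Real.pi, circPt q0 (κ * y) * Hp (circPt q0 (κ * y))) +
      I * (∫ y in Real.pi..(2 * Real.pi), circPt q0 (κ * y) * Hm (circPt q0 (κ * y))) -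
      2 * Real.pi * I * C := by
  have hκ0 : κ ≠ 0 := by rintro rfl; simp at hκ
  have hpi : exp (κ * (Real.pi * I)) = ((-1 : ℝ) : ℂ) := by
    rcases (abs_eq zero_le_one).1 hκ with rfl | rfl
    · simp [Complex.exp_pi_mul_I]
    · simp [Complex.exp_neg, Complex.exp_pi_mul_I]
  have hpi2 : exp (κ * ((Real.pi + Real.pi : ℝ) * I)) = ((1 : ℝ) : ℂ) := by
    push_cast
    rw [add_mul, mul_add, Complex.exp_add, hpi]; norm_num
  have hDp' := hDp.trans (Dplus_subset q0)
  have hDm' := hDm.trans (Dminus_subset q0)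
  obtain ⟨p1, p2, p3, p4⟩ := region_cauchy hq0 (κ := κ) (a := 0) (σ := 1) (σ' := -1) hκ0
    (by simp) (by rw [zero_add]; exact hpi) (by simp) (by simp) hDp' hmapp hH.differentiableOn
    (fun ξ h1 h2 h3 => (hH.plus ξ h1 h2 h3).mono_left (nhdsWithin_mono _ hDp)) hH.nodes
    (hC.mono_left (inf_le_inf le_rfl (principal_mono.2 fun w hw => hDp' (hmapp w hw))))
  obtain ⟨m1, m2, m3, m4⟩ := region_cauchy hq0 (κ := κ) (a := Real.pi) (σ := -1) (σ' := 1) hκ0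
    hpi hpi2 (by simp) (by simp) hDm' hmapm hH.differentiableOn
    (fun ξ h1 h2 h3 => (hH.minus ξ h1 h2 h3).mono_left (nhdsWithin_mono _ hDm)) hH.nodes
    (hC.mono_left (inf_le_inf le_rfl (principal_mono.2 fun w hw => hDm' (hmapm w hw))))
  obtain ⟨r1, r2⟩ := ray_integral hq0 hκ (σ := 1) (by simp) (J := fun ξ => Hp ξ - Hm ξ) hTp hJ
  obtain ⟨l1, l2⟩ := ray_integral hq0 hκ (σ := -1) (by simp) (J := fun ξ => Hp ξ - Hm ξ) hTm hJ
  rw [zero_add] at p1 p4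
  rw [← two_mul] at m1 m4
  refine ⟨p1, m1, ?_⟩
  have hl := (intervalIntegral_tendsto_integral_Ioi 0 r1 tendsto_id).add
    (intervalIntegral_tendsto_integral_Ioi 0 l1 tendsto_id)
  rw [r2, l2] at hl
  have hr := p4.add m4
  -- The four ray integrals are regrouped at finite `R`, because only the jump, not `H⁺` and `H⁻`
  -- separately, is known to be integrable along whole rays.
  have := tendsto_nhds_unique (hl.congr' ?_) hr
  · rw [this]; ring
  · filter_upwards [eventually_gt_atTop 0] with R hR
    have e1 := intervalIntegral.integral_sub (p2 R hR) (m3 R hR)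
    have e2 := intervalIntegral.integral_sub (p3 R hR) (m2 R hR)
    have e1' : ∫ s in (0 : ℝ)..R, (q0 * Real.exp (κ * s) : ℝ) *
        (Hp ((1 * (q0 * Real.exp (κ * s)) : ℝ) : ℂ) - Hm ((1 * (q0 * Real.exp (κ * s)) : ℝ) : ℂ))
        = ∫ s in (0 : ℝ)..R, (((1 * (q0 * Real.exp (κ * s)) : ℝ) : ℂ) *
          Hp ((1 * (q0 * Real.exp (κ * s)) : ℝ) : ℂ) - ((1 * (q0 * Real.exp (κ * s)) : ℝ) : ℂ) *
          Hm ((1 * (q0 * Real.exp (κ * s)) : ℝ) : ℂ)) := by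
      congr 1; ext s; push_cast; ring
    have e2' : ∫ s in (0 : ℝ)..R, (q0 * Real.exp (κ * s) : ℝ) *
        (Hp ((-1 * (q0 * Real.exp (κ * s)) : ℝ) : ℂ) -
          Hm ((-1 * (q0 * Real.exp (κ * s)) : ℝ) : ℂ))
        = -∫ s in (0 : ℝ)..R, (((-1 * (q0 * Real.exp (κ * s)) : ℝ) : ℂ) *
          Hp ((-1 * (q0 * Real.exp (κ * s)) : ℝ) : ℂ) - ((-1 * (q0 * Real.exp (κ * s)) : ℝ) : ℂ) *
          Hm ((-1 * (q0 * Real.exp (κ * s)) : ℝ) : ℂ)) := by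
      rw [← intervalIntegral.integral_neg]
      congr 1; ext s; push_cast; ring
    simp only [id]
    rw [e1', e2', e1, e2]
    ring

lemma circPt_two_pi_sub (q0 y : ℝ) : circPt q0 (-1 * (2 * Real.pi - y)) = circPt q0 y := by
  have : I * ((-1 * (2 * Real.pi - y) : ℝ) : ℂ) = I * y - 2 * Real.pi * I := by push_cast; ring
  rw [circPt, this, Complex.exp_periodic.sub_eq, circPt]

/-- The identity for the inside of the circle is subtracted from that for the outside. With the
orientation of `Σ` all arc integrals cancel, and only the coefficients at infinity and at the origin
remain. Integrability of the jump is needed on the real line only: on the arcs it follows from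
boundedness. -/
theorem sigmaIntegral_jump {q0 : ℝ} (hq0 : 0 < q0) {H Hp Hm : ℂ → ℂ} {A B : ℂ}
    (hH : IsPiecewiseHolomorphic q0 H Hp Hm)
    (hA : Tendsto (fun ξ => ξ * H ξ) (Bornology.cobounded ℂ ⊓ 𝓟 (Sigma q0)ᶜ) (𝓝 A))
    (hB : Tendsto (fun ξ => ξ * H ξ) (𝓝[(Sigma q0)ᶜ] 0) (𝓝 B))
    (hJ : Integrable (fun s : ℝ => Hp s - Hm s)) :
    sigmaIntegral q0 (fun ξ => Hp ξ - Hm ξ) = -(2 * Real.pi * I * (A - B)) := by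
  have hexp : ∀ κ s : ℝ, 0 < q0 * Real.exp (κ * s) := fun κ s => by positivity
  have sinpos : ∀ w ∈ halfStrip 0 (0 + Real.pi), 0 < Real.sin w.im := fun w hw =>
    Real.sin_pos_of_pos_of_lt_pi hw.2.1 (by simpa using hw.2.2)
  have sinneg : ∀ w ∈ halfStrip Real.pi (Real.pi + Real.pi), Real.sin w.im < 0 := fun w hw => by
    have := Real.sin_pos_of_pos_of_lt_pi (x := w.im - Real.pi) (by linarith [hw.2.1])
      (by linarith [hw.2.2])
    rw [Real.sin_sub_pi] at this
    linarith
  have hgt : ∀ w : ℂ, 0 < w.re → q0 < ‖(q0 * exp ((1 : ℝ) * w) : ℂ)‖ := fun w hw => by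
    rw [norm_expMap hq0, one_mul]
    have := Real.one_lt_exp_iff.2 hw
    nlinarith
  have hlt : ∀ w : ℂ, 0 < w.re → ‖(q0 * exp ((-1 : ℝ) * w) : ℂ)‖ < q0 := fun w hw => by
    rw [norm_expMap hq0]
    have : Real.exp (-1 * w.re) < 1 := Real.exp_lt_one_iff.2 (by linarith)
    nlinarith
  have hCo : Tendsto (fun w : ℂ => (q0 * exp ((1 : ℝ) * w) : ℂ) * H (q0 * exp ((1 : ℝ) * w)))
      (comap re atTop ⊓ 𝓟 {w | (q0 * exp ((1 : ℝ) * w) : ℂ) ∈ (Sigma q0)ᶜ}) (𝓝 A) := by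
    refine hA.comp (f := fun w : ℂ => (q0 * exp ((1 : ℝ) * w) : ℂ)) (tendsto_inf.2 ⟨?_, ?_⟩)
    · rw [← tendsto_norm_atTop_iff_cobounded]
      simp only [norm_expMap hq0, one_mul]
      exact ((Real.tendsto_exp_atTop.comp tendsto_comap).const_mul_atTop hq0).mono_left inf_le_left
    · exact tendsto_principal.2 (by
        filter_upwards [mem_inf_of_right (mem_principal_self _)] with w hw using hw)
  have hTo : (fun s : ℝ => 1 * (q0 * Real.exp (1 * s))) '' Set.Ioi 0 = Set.Ioi q0 := by
    ext u
    simp only [Set.mem_image, Set.mem_Ioi, one_mul]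
    constructor
    · rintro ⟨s, hs, rfl⟩
      have := Real.one_lt_exp_iff.2 hs
      nlinarith
    · intro hu
      refine ⟨Real.log (u / q0), Real.log_pos ((one_lt_div hq0).2 hu), ?_⟩
      rw [Real.exp_log (div_pos (hq0.trans hu) hq0)]
      field_simp
  have hTo' : (fun s : ℝ => (-1) * (q0 * Real.exp (1 * s))) '' Set.Ioi 0 = Set.Iio (-q0) := by
    ext u
    simp only [Set.mem_image, Set.mem_Ioi, one_mul, Set.mem_Iio]
    constructor
    · rintro ⟨s, hs, rfl⟩
      have := Real.one_lt_exp_iff.2 hs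
      nlinarith
    · intro hu
      refine ⟨Real.log (-u / q0), Real.log_pos ((one_lt_div hq0).2 (by linarith)), ?_⟩
      rw [Real.exp_log (div_pos (by linarith) hq0)]
      field_simp
  obtain ⟨o1, o2, o3⟩ := two_regions_cauchy hq0 (κ := 1) (by simp) (Dp := D1 q0) (Dm := D2 q0)
    Set.subset_union_left Set.subset_union_left
    (fun w hw => ⟨hgt w hw.1, by
      rw [im_expMap, one_mul, one_mul]
      exact mul_pos hq0 (mul_pos (Real.exp_pos _) (sinpos w hw))⟩)
    (fun w hw => ⟨hgt w hw.1, by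
      rw [im_expMap, one_mul, one_mul]
      exact mul_neg_of_pos_of_neg hq0 (mul_neg_of_pos_of_neg (Real.exp_pos _) (sinneg w hw))⟩)
    hH (C := A) hCo (Tp := Set.Ioi q0) (Tm := Set.Iio (-q0)) hTo hTo' hJ
  have hCi : Tendsto (fun w : ℂ => (q0 * exp ((-1 : ℝ) * w) : ℂ) * H (q0 * exp ((-1 : ℝ) * w)))
      (comap re atTop ⊓ 𝓟 {w | (q0 * exp ((-1 : ℝ) * w) : ℂ) ∈ (Sigma q0)ᶜ}) (𝓝 B) := by
    refine hB.comp (f := fun w : ℂ => (q0 * exp ((-1 : ℝ) * w) : ℂ))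
      (tendsto_nhdsWithin_iff.2 ⟨?_, ?_⟩)
    · rw [tendsto_zero_iff_norm_tendsto_zero]
      simp only [norm_expMap hq0, neg_one_mul]
      have := (Real.tendsto_exp_neg_atTop_nhds_zero.comp
        (tendsto_comap (f := re) (x := atTop))).const_mul q0
      rw [mul_zero] at this
      exact this.mono_left inf_le_left
    · filter_upwards [mem_inf_of_right (mem_principal_self _)] with w hw using hw
  have hTi : (fun s : ℝ => 1 * (q0 * Real.exp (-1 * s))) '' Set.Ioi 0 = Set.Ioo 0 q0 := by
    ext u
    simp only [Set.mem_image, Set.mem_Ioi, one_mul, Set.mem_Ioo]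
    constructor
    · rintro ⟨s, hs, rfl⟩
      have : Real.exp (-1 * s) < 1 := Real.exp_lt_one_iff.2 (by linarith)
      exact ⟨hexp _ _, by nlinarith⟩
    · rintro ⟨hu0, hu⟩
      refine ⟨-Real.log (u / q0), neg_pos.2 (Real.log_neg (div_pos hu0 hq0)
        ((div_lt_one hq0).2 hu)), ?_⟩
      rw [neg_one_mul, neg_neg, Real.exp_log (div_pos hu0 hq0)]
      field_simp
  have hTi' : (fun s : ℝ => (-1) * (q0 * Real.exp (-1 * s))) '' Set.Ioi 0 = Set.Ioo (-q0) 0 := by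
    ext u
    simp only [Set.mem_image, Set.mem_Ioi, Set.mem_Ioo]
    constructor
    · rintro ⟨s, hs, rfl⟩
      have : Real.exp (-1 * s) < 1 := Real.exp_lt_one_iff.2 (by linarith)
      have := hexp (-1) s
      exact ⟨by nlinarith, by linarith⟩
    · rintro ⟨hu, hu0⟩
      refine ⟨-Real.log (-u / q0), neg_pos.2 (Real.log_neg (div_pos (by linarith) hq0)
        ((div_lt_one hq0).2 (by linarith))), ?_⟩
      rw [neg_one_mul (-Real.log _), neg_neg, Real.exp_log (div_pos (by linarith) hq0)]
      field_simp
  -- The map `w ↦ q₀ e^{-w}` reverses angles, so the first strip goes to the lower half disc `D₃`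
  -- and the plus region again comes first.
  obtain ⟨i1, i2, i3⟩ := two_regions_cauchy hq0 (κ := -1) (by simp) (Dp := D3 q0) (Dm := D4 q0)
    Set.subset_union_right Set.subset_union_right
    (fun w hw => ⟨hlt w hw.1, by
      rw [im_expMap, neg_one_mul w.im, Real.sin_neg]
      exact mul_neg_of_pos_of_neg hq0 (mul_neg_of_pos_of_neg (Real.exp_pos _)
        (neg_lt_zero.2 (sinpos w hw)))⟩)
    (fun w hw => ⟨hlt w hw.1, by
      rw [im_expMap, neg_one_mul w.im, Real.sin_neg]
      exact mul_pos hq0 (mul_pos (Real.exp_pos _) (neg_pos.2 (sinneg w hw)))⟩)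
    hH (C := B) hCi (Tp := Set.Ioo 0 q0) (Tm := Set.Ioo (-q0) 0) hTi hTi' hJ
  have hout : ∫ s in {s : ℝ | q0 < |s|}, (Hp s - Hm s) =
      (∫ s in Set.Ioi q0, (Hp s - Hm s)) + ∫ s in Set.Iio (-q0), (Hp s - Hm s) := by
    have : {s : ℝ | q0 < |s|} = Set.Ioi q0 ∪ Set.Iio (-q0) := by
      ext s; simp only [Set.mem_ofPred_eq, lt_abs, Set.mem_union, Set.mem_Ioi, Set.mem_Iio]
      exact or_congr_right lt_neg
    rw [this, setIntegral_union _ measurableSet_Iio hJ.integrableOn hJ.integrableOn]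
    exact Set.disjoint_left.2 fun s h1 h2 => by
      simp only [Set.mem_Ioi, Set.mem_Iio] at h1 h2; linarith
  have hin : ∫ s in {s : ℝ | |s| < q0}, (Hp s - Hm s) =
      (∫ s in Set.Ioo 0 q0, (Hp s - Hm s)) + ∫ s in Set.Ioo (-q0) 0, (Hp s - Hm s) := by
    have : {s : ℝ | |s| < q0} = Set.Ioo (-q0) q0 := by
      ext s; simp [abs_lt]
    rw [this, ← integral_Ioc_eq_integral_Ioo, ← integral_Ioc_eq_integral_Ioo,
      ← integral_Ioc_eq_integral_Ioo, ← intervalIntegral.integral_of_le (by linarith),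
      ← intervalIntegral.integral_of_le hq0.le, ← intervalIntegral.integral_of_le (by linarith),
      add_comm, intervalIntegral.integral_add_adjacent_intervals hJ.intervalIntegrable
        hJ.intervalIntegrable]
  simp only [one_mul] at o1 o2 o3
  -- reflect the angle in the inner regions
  have hrefl : ∀ V : ℂ → ℂ, ∀ a b : ℝ,
      ∫ y in a..b, circPt q0 (-1 * y) * V (circPt q0 (-1 * y)) =
      ∫ y in (2 * Real.pi - b)..(2 * Real.pi - a), circPt q0 y * V (circPt q0 y) := by
    intro V a b
    have := intervalIntegral.integral_comp_sub_left (a := 2 * Real.pi - b)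
      (b := 2 * Real.pi - a) (fun y => circPt q0 (-1 * y) * V (circPt q0 (-1 * y))) (2 * Real.pi)
    simp only [circPt_two_pi_sub, sub_sub_cancel] at this
    exact this.symm
  have hreflInt : ∀ V : ℂ → ℂ, ∀ a b : ℝ, IntervalIntegrable
      (fun y : ℝ => circPt q0 (-1 * y) * V (circPt q0 (-1 * y))) volume a b →
      IntervalIntegrable (fun y : ℝ => circPt q0 y * V (circPt q0 y)) volume
        (2 * Real.pi - a) (2 * Real.pi - b) := by
    intro V a b h
    have := h.comp_sub_left (2 * Real.pi)
    simpa only [circPt_two_pi_sub] using this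
  rw [hrefl, hrefl] at i3
  have i1' := (hreflInt _ _ _ i1).symm
  have i2' := (hreflInt _ _ _ i2).symm
  rw [show 2 * Real.pi - Real.pi = Real.pi by ring, sub_zero] at i1' i3
  rw [show 2 * Real.pi - Real.pi = Real.pi by ring, sub_self] at i2'
  rw [sub_self] at i3
  have hc : ∀ a b : ℝ,
      IntervalIntegrable (fun y : ℝ => circPt q0 y * Hp (circPt q0 y)) volume a b →
      IntervalIntegrable (fun y : ℝ => circPt q0 y * Hm (circPt q0 y)) volume a b →
      ∫ y in a..b, (Hp (circPt q0 y) - Hm (circPt q0 y)) * (I * circPt q0 y) =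
      I * (∫ y in a..b, circPt q0 y * Hp (circPt q0 y)) -
        I * ∫ y in a..b, circPt q0 y * Hm (circPt q0 y) := by
    intro a b h1 h2
    rw [← mul_sub, ← intervalIntegral.integral_sub h1 h2, ← intervalIntegral.integral_const_mul]
    congr 1; ext y; ring
  simp only [sigmaIntegral]
  rw [hout, hin, o3, i3, hc _ _ o1 i2', hc _ _ i1' o2]
  ring

/-! ### Cauchy's integral formula on `Σ` and the coefficient at infinity. -/

lemma isClosed_Sigma (q0 : ℝ) : IsClosed (Sigma q0) :=
  (isClosed_eq continuous_im continuous_const).union (isClosed_eq continuous_norm continuous_const)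

lemma real_mem_Sigma (q0 s : ℝ) : (s : ℂ) ∈ Sigma q0 := Or.inl (ofReal_im s)

lemma circPt_mem_Sigma {q0 : ℝ} (hq0 : 0 < q0) (s : ℝ) : circPt q0 s ∈ Sigma q0 := by
  right; simp [circPt, Complex.norm_exp, abs_of_pos hq0]

lemma node_mem_Sigma {q0 : ℝ} (hq0 : 0 < q0) {ξ : ℂ} (h : ξ ^ 4 = (q0 : ℂ) ^ 4) :
    ξ ∈ Sigma q0 := by
  right
  have := congrArg norm h
  rw [norm_pow, norm_pow, norm_real, Real.norm_eq_abs, abs_of_pos hq0] at this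
  exact (pow_left_inj₀ (norm_nonneg _) hq0.le (by norm_num)).1 this

/-- Cauchy's integral formula for a piecewise holomorphic function. -/
theorem IsPiecewiseHolomorphic.eq_cauchy {q0 : ℝ} (hq0 : 0 < q0) {F Fp Fm : ℂ → ℂ} {a B : ℂ}
    (hF : IsPiecewiseHolomorphic q0 F Fp Fm)
    (hinf : Tendsto F (Bornology.cobounded ℂ ⊓ 𝓟 (Sigma q0)ᶜ) (𝓝 a))
    (h0 : Tendsto (fun ξ => ξ * F ξ) (𝓝[(Sigma q0)ᶜ] 0) (𝓝 B))
    (hJ : Integrable (fun s : ℝ => Fp s - Fm s)) {z : ℂ} (hz : z ∉ Sigma q0) :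
    F z = a + B / z + 1 / (2 * Real.pi * I) *
      sigmaIntegral q0 (fun ξ => (Fp ξ - Fm ξ) / (ξ - z)) := by
  have hzim : z.im ≠ 0 := fun h => hz (Or.inl h)
  have hz0 : z ≠ 0 := by rintro rfl; simp at hzim
  have hzn : (Sigma q0)ᶜ ∈ 𝓝 z := (isClosed_Sigma q0).isOpen_compl.mem_nhds hz
  -- `sigmaIntegral_jump` is applied to the difference quotient of `F` at `z`, which is holomorphic
  -- at `z` too. The constant `F z` drops out of the jump and reappears in the coefficient `a - F z`
  -- at infinity; the one at the origin is `-B / z`.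
  have hds : ∀ ξ, ξ ≠ z → dslope F z ξ = (F ξ - F z) / (ξ - z) := fun ξ h => by
    rw [dslope_of_ne _ h, slope_def_field]
  have hev : ∀ ξ, ξ ≠ z → dslope F z =ᶠ[𝓝 ξ] fun ξ => (F ξ - F z) / (ξ - z) := fun ξ h => by
    filter_upwards [isOpen_ne.mem_nhds h] with v hv using hds v hv
  have hlim : ∀ (T : Set ℂ) (ξ v : ℂ), ξ ≠ z → Tendsto F (𝓝[T] ξ) (𝓝 v) →
      Tendsto (dslope F z) (𝓝[T] ξ) (𝓝 ((v - F z) / (ξ - z))) := by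
    intro T ξ v hne h
    refine Tendsto.congr' ((hev ξ hne).symm.filter_mono nhdsWithin_le_nhds) ?_
    exact (h.sub_const _).div ((tendsto_id.mono_left nhdsWithin_le_nhds).sub_const _)
      (sub_ne_zero.2 hne)
  have hne : ∀ ξ ∈ Sigma q0, ξ ≠ z := fun ξ h h' => hz (h' ▸ h)
  have hH : IsPiecewiseHolomorphic q0 (dslope F z) (fun ξ => (Fp ξ - F z) / (ξ - z))
      (fun ξ => (Fm ξ - F z) / (ξ - z)) := by
    refine ⟨(differentiableOn_dslope hzn).2 hF.differentiableOn,
      fun ξ h1 h2 h3 => hlim _ _ _ (hne ξ h1) (hF.plus ξ h1 h2 h3),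
      fun ξ h1 h2 h3 => hlim _ _ _ (hne ξ h1) (hF.minus ξ h1 h2 h3), fun ξ h => ?_⟩
    have hξ := hne ξ (node_mem_Sigma hq0 h)
    refine Asymptotics.IsBigO.congr' ?_ ((hev ξ hξ).symm.filter_mono nhdsWithin_le_nhds)
      EventuallyEq.rfl
    have h1 : (fun v : ℂ => (v - z)⁻¹) =O[𝓝[(Sigma q0)ᶜ] ξ] (fun _ => (1 : ℂ)) :=
      (((tendsto_id.mono_left nhdsWithin_le_nhds).sub_const z).inv₀ (sub_ne_zero.2 hξ)).isBigO_one ℂ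
    simpa [div_eq_mul_inv] using
      ((hF.nodes ξ h).sub (Asymptotics.isBigO_const_const (F z) one_ne_zero _)).mul h1
  have hratio : Tendsto (fun ξ : ℂ => ξ / (ξ - z)) (Bornology.cobounded ℂ) (𝓝 1) := by
    have h1 : Tendsto (fun ξ : ℂ => 1 - z * ξ⁻¹) (Bornology.cobounded ℂ) (𝓝 (1 - z * 0)) :=
      (tendsto_inv₀_cobounded.const_mul z).const_sub 1
    have h2 := h1.inv₀ (by simp)
    rw [mul_zero, sub_zero, inv_one] at h2
    refine h2.congr' ?_
    filter_upwards [Bornology.eventually_ne_cobounded (0 : ℂ)] with ξ hξ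
    rw [← inv_div]; congr 1; field_simp
  have hA : Tendsto (fun ξ => ξ * dslope F z ξ) (Bornology.cobounded ℂ ⊓ 𝓟 (Sigma q0)ᶜ)
      (𝓝 (a - F z)) := by
    have h1 := (hratio.mono_left inf_le_left).mul (hinf.sub_const (F z))
    rw [one_mul] at h1
    refine h1.congr' ?_
    filter_upwards [(Bornology.eventually_ne_cobounded z).filter_mono inf_le_left] with ξ hξ
    rw [hds ξ hξ]; ring
  have hB : Tendsto (fun ξ => ξ * dslope F z ξ) (𝓝[(Sigma q0)ᶜ] 0) (𝓝 (-(B / z))) := by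
    have hid : Tendsto (fun ξ : ℂ => ξ) (𝓝[(Sigma q0)ᶜ] 0) (𝓝 0) :=
      tendsto_id.mono_left nhdsWithin_le_nhds
    have h1 := (h0.sub (hid.mul_const (F z))).div (hid.sub_const z)
      (by simpa using hz0)
    have h2 : (B - 0 * F z) / (0 - z) = -(B / z) := by rw [zero_mul, sub_zero, zero_sub, div_neg]
    rw [h2] at h1
    refine h1.congr' ?_
    filter_upwards [nhdsWithin_le_nhds (isOpen_ne.mem_nhds hz0.symm)] with ξ hξ
    rw [hds ξ hξ]; simp only [Pi.div_apply]; ring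
  have hsub : ∀ ξ, (Fp ξ - F z) / (ξ - z) - (Fm ξ - F z) / (ξ - z) = (Fp ξ - Fm ξ) / (ξ - z) :=
    fun ξ => by ring
  have hJ' : Integrable (fun s : ℝ => (Fp s - F z) / (s - z) - (Fm s - F z) / (s - z)) := by
    simp only [hsub]
    simp only [div_eq_mul_inv]
    refine hJ.mul_bdd (c := |z.im|⁻¹) ?_ (ae_of_all _ fun s => ?_)
    · exact (by fun_prop : Measurable fun s : ℝ => ((s : ℂ) - z)⁻¹).aestronglyMeasurable
    · rw [norm_inv]
      refine inv_anti₀ (abs_pos.2 hzim) ?_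
      simpa using abs_im_le_norm ((s : ℂ) - z)
  have := sigmaIntegral_jump hq0 hH hA hB hJ'
  simp only [hsub] at this
  rw [this]
  have hpi : (Real.pi : ℂ) ≠ 0 := by exact_mod_cast Real.pi_ne_zero
  field_simp
  ring

/-- Dominated convergence along `Σ`, for bounded factors. -/
lemma tendsto_sigmaIntegral_mul {q0 : ℝ} (hq0 : 0 < q0) {J : ℂ → ℂ} (hJ : SigmaIntegrable q0 J)
    {k : ℝ → ℂ → ℂ} {κ : ℂ → ℂ} {c : ℝ} (hk : ∀ y, Measurable (k y))
    (hb : ∀ᶠ y in atTop, ∀ ξ ∈ Sigma q0, ‖k y ξ‖ ≤ c)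
    (hlim : ∀ ξ ∈ Sigma q0, Tendsto (fun y => k y ξ) atTop (𝓝 (κ ξ))) :
    Tendsto (fun y => sigmaIntegral q0 (fun ξ => k y ξ * J ξ)) atTop
      (𝓝 (sigmaIntegral q0 (fun ξ => κ ξ * J ξ))) := by
  have hreal : ∀ T : Set ℝ, Tendsto (fun y => ∫ s in T, k y s * J s) atTop
      (𝓝 (∫ s in T, κ s * J s)) := by
    intro T
    refine tendsto_integral_filter_of_dominated_convergence (fun s => c * ‖J s‖) ?_ ?_
      (hJ.1.integrableOn.norm.const_mul c) ?_
    · exact Eventually.of_forall fun y =>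
        ((hk y).comp measurable_ofReal).aestronglyMeasurable.mul hJ.1.aestronglyMeasurable.restrict
    · filter_upwards [hb] with y hy
      refine ae_of_all _ fun s => ?_
      rw [norm_mul]
      exact mul_le_mul_of_nonneg_right (hy _ (real_mem_Sigma q0 s)) (norm_nonneg _)
    · exact ae_of_all _ fun s => (hlim _ (real_mem_Sigma q0 s)).mul_const _
  have hcirc : ∀ a b : ℝ, IntervalIntegrable (fun s : ℝ => J (circPt q0 s)) volume a b →
      Tendsto (fun y => ∫ s in a..b, k y (circPt q0 s) * J (circPt q0 s) * (I * circPt q0 s)) atTop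
      (𝓝 (∫ s in a..b, κ (circPt q0 s) * J (circPt q0 s) * (I * circPt q0 s))) := by
    intro a b hab
    have hcm : Measurable (circPt q0) := by unfold circPt; fun_prop
    refine intervalIntegral.tendsto_integral_filter_of_dominated_convergence
      (fun s => c * ‖J (circPt q0 s)‖ * q0) ?_ ?_ ((hab.norm.const_mul c).mul_const q0) ?_
    · refine Eventually.of_forall fun y => ?_
      refine AEStronglyMeasurable.mul (AEStronglyMeasurable.mul
        ((hk y).comp hcm).aestronglyMeasurable ?_)
        (hcm.const_mul I).aestronglyMeasurable
      exact (intervalIntegrable_iff.1 hab).aestronglyMeasurable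
    · filter_upwards [hb] with y hy
      refine ae_of_all _ fun s _ => ?_
      have h1 : ‖circPt q0 s‖ = q0 := by simp [circPt, Complex.norm_exp, abs_of_pos hq0]
      rw [norm_mul, norm_mul, norm_mul, norm_I, one_mul, h1]
      gcongr
      exact hy _ (circPt_mem_Sigma hq0 s)
    · exact ae_of_all _ fun s _ => ((hlim _ (circPt_mem_Sigma hq0 s)).mul_const _).mul_const _
  have hpi := Real.pi_pos
  have i1 : IntervalIntegrable (fun s : ℝ => J (circPt q0 s)) volume 0 Real.pi :=
    hJ.2.mono_set (by
      rw [Set.uIcc_of_le hpi.le, Set.uIcc_of_le (by linarith)]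
      exact Set.Icc_subset_Icc_right (by linarith))
  have i2 : IntervalIntegrable (fun s : ℝ => J (circPt q0 s)) volume Real.pi (2 * Real.pi) :=
    hJ.2.mono_set (by
      rw [Set.uIcc_of_le (by linarith), Set.uIcc_of_le (by linarith)]
      exact Set.Icc_subset_Icc_left (by linarith))
  exact (((hreal _).sub (hreal _)).add (hcirc _ _ i2)).sub (hcirc _ _ i1)

/-- The `1 / z` coefficient of a piecewise holomorphic function along the imaginary axis. -/
theorem IsPiecewiseHolomorphic.tendsto_coeff {q0 : ℝ} (hq0 : 0 < q0) {F Fp Fm : ℂ → ℂ} {a B : ℂ}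
    (hF : IsPiecewiseHolomorphic q0 F Fp Fm)
    (hinf : Tendsto F (Bornology.cobounded ℂ ⊓ 𝓟 (Sigma q0)ᶜ) (𝓝 a))
    (h0 : Tendsto (fun ξ => ξ * F ξ) (𝓝[(Sigma q0)ᶜ] 0) (𝓝 B))
    (hJ : SigmaIntegrable q0 (fun ξ => Fp ξ - Fm ξ)) :
    Tendsto (fun y : ℝ => (y * I : ℂ) * (F (y * I) - a)) atTop
      (𝓝 (B - 1 / (2 * Real.pi * I) * sigmaIntegral q0 (fun ξ => Fp ξ - Fm ξ))) := by
  have hmul : ∀ (c : ℂ) (f : ℂ → ℂ),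
      sigmaIntegral q0 (fun ξ => c * f ξ) = c * sigmaIntegral q0 f := by
    intro c f
    simp only [sigmaIntegral, mul_assoc, integral_const_mul, intervalIntegral.integral_const_mul]
    ring
  -- The factor `iy` is absorbed into the Cauchy kernel, which then tends to `-1`. For `y ≥ 2q₀`
  -- every point of `Σ` is at distance at least `y/2` from `iy`, whence the bound `2`.
  have hk := tendsto_sigmaIntegral_mul hq0 hJ (k := fun y ξ => (y * I) / (ξ - y * I))
    (κ := fun _ => -1) (c := 2) (fun y => by fun_prop) ?_ ?_
  · have h1 := (hk.const_mul (1 / (2 * Real.pi * I) : ℂ)).const_add B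
    rw [hmul, ← mul_assoc, mul_neg_one, neg_mul, ← sub_eq_add_neg] at h1
    refine h1.congr' ?_
    filter_upwards [eventually_gt_atTop q0] with y hy
    have hy0 : 0 < y := hq0.trans hy
    have hyS : (y * I : ℂ) ∉ Sigma q0 := by
      rintro (h | h)
      · simp at h; exact hy0.ne' h
      · simp [abs_of_pos hy0] at h; exact hy.ne' h
    have hyI : (y * I : ℂ) ≠ 0 := mul_ne_zero (by exact_mod_cast hy0.ne') I_ne_zero
    have h2 : sigmaIntegral q0 (fun ξ => (y * I) / (ξ - y * I) * (Fp ξ - Fm ξ)) =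
        (y * I) * sigmaIntegral q0 (fun ξ => (Fp ξ - Fm ξ) / (ξ - y * I)) := by
      rw [← hmul]; congr 1; ext ξ; ring
    rw [hF.eq_cauchy hq0 hinf h0 hJ.1 hyS, h2]
    have h3 : (y * I : ℂ) * (B / (y * I)) = B := mul_div_cancel₀ B hyI
    linear_combination -h3
  · filter_upwards [eventually_ge_atTop (2 * q0)] with y hy ξ hξ
    have hy0 : 0 < y := by linarith
    have hn : ‖(y * I : ℂ)‖ = y := by simp [abs_of_pos hy0]
    rw [norm_div, hn]
    have h1 : y / 2 ≤ ‖ξ - y * I‖ := by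
      rcases hξ with h | h
      · have := abs_im_le_norm (ξ - y * I)
        simp only [sub_im, h, mul_im, ofReal_re, I_im, ofReal_im, I_re] at this
        rw [mul_one, mul_zero, add_zero, zero_sub, abs_neg, abs_of_pos hy0] at this
        linarith
      · have := norm_sub_norm_le (y * I : ℂ) ξ
        rw [hn, h, norm_sub_rev] at this
        linarith
    rw [div_le_iff₀ (by linarith)]
    linarith
  · intro ξ _
    have h1 : Tendsto (fun y : ℝ => (y * I : ℂ)) atTop (Bornology.cobounded ℂ) := by
      rw [← tendsto_norm_atTop_iff_cobounded]
      simpa using tendsto_abs_atTop_atTop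
    have h2 : Tendsto (fun v : ℂ => (ξ * v⁻¹ - 1)⁻¹) (Bornology.cobounded ℂ)
        (𝓝 ((ξ * 0 - 1)⁻¹)) :=
      ((tendsto_inv₀_cobounded.const_mul ξ).sub_const 1).inv₀ (by simp)
    have h3 := h2.comp h1
    rw [mul_zero, zero_sub, inv_neg, inv_one] at h3
    refine h3.congr' ?_
    filter_upwards [eventually_gt_atTop 0] with y hy
    have hyI : (y * I : ℂ) ≠ 0 := mul_ne_zero (by exact_mod_cast hy.ne') I_ne_zero
    simp only [Function.comp]
    rw [← inv_div]; congr 1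
    rw [sub_div, div_self hyI, div_eq_mul_inv]

/-! ### Removal of simple poles -/

/-- The sum of the principal parts of simple poles. -/
noncomputable def polarPart {ι : Type*} [Fintype ι] (p r : ι → ℂ) (w : ℂ) : ℂ :=
  ∑ i, r i / (w - p i)

section polarPart

variable {ι : Type*} [Fintype ι] {p r : ι → ℂ}

lemma differentiableAt_polarPart {w : ℂ} (hw : w ∉ Set.range p) :
    DifferentiableAt ℂ (polarPart p r) w := by
  unfold polarPart
  refine DifferentiableAt.fun_sum fun i _ => ?_
  refine (differentiableAt_const _).div (by fun_prop) (sub_ne_zero.2 ?_)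
  rintro rfl; exact hw ⟨i, rfl⟩

lemma tendsto_polarPart_cobounded : Tendsto (polarPart p r) (Bornology.cobounded ℂ) (𝓝 0) := by
  unfold polarPart
  rw [← Finset.sum_const_zero (ι := ι) (s := Finset.univ)]
  refine tendsto_finsetSum _ fun i _ => ?_
  have h1 : Tendsto (fun w : ℂ => w - p i) (Bornology.cobounded ℂ) (Bornology.cobounded ℂ) := by
    rw [← tendsto_norm_atTop_iff_cobounded]
    refine tendsto_atTop_mono (fun w => norm_sub_norm_le w (p i)) ?_
    exact tendsto_atTop_add_const_right _ _ tendsto_norm_cobounded_atTop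
  simpa [div_eq_mul_inv] using (tendsto_inv₀_cobounded.comp h1).const_mul (r i)

lemma tendsto_mul_polarPart_imaginary :
    Tendsto (fun y : ℝ => (y * I : ℂ) * polarPart p r (y * I)) atTop (𝓝 (∑ i, r i)) := by
  unfold polarPart
  simp only [Finset.mul_sum]
  refine tendsto_finsetSum _ fun i _ => ?_
  have h1 : Tendsto (fun y : ℝ => (y * I : ℂ)) atTop (Bornology.cobounded ℂ) := by
    rw [← tendsto_norm_atTop_iff_cobounded]
    simpa using tendsto_abs_atTop_atTop
  have h2 : Tendsto (fun v : ℂ => r i * (1 - p i * v⁻¹)⁻¹) (Bornology.cobounded ℂ)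
      (𝓝 (r i * (1 - p i * 0)⁻¹)) :=
    (((tendsto_inv₀_cobounded.const_mul (p i)).const_sub 1).inv₀ (by simp)).const_mul (r i)
  have h3 := h2.comp h1
  rw [mul_zero, sub_zero, inv_one, mul_one] at h3
  refine h3.congr' ?_
  filter_upwards [eventually_gt_atTop 0] with y hy
  have hyI : (y * I : ℂ) ≠ 0 := mul_ne_zero (by exact_mod_cast hy.ne') I_ne_zero
  simp only [Function.comp]
  have : (1 : ℂ) - p i * (y * I)⁻¹ = (y * I - p i) / (y * I) := by
    rw [sub_div, div_self hyI, div_eq_mul_inv]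
  rw [this, inv_div]; ring

lemma tendsto_sub_mul_polarPart (hp : Function.Injective p) (i : ι) :
    Tendsto (fun w => (w - p i) * polarPart p r w) (𝓝[≠] (p i)) (𝓝 (r i)) := by
  classical
  unfold polarPart
  have h1 : ∀ j, Tendsto (fun w => (w - p i) * (r j / (w - p j))) (𝓝[≠] (p i))
      (𝓝 (if j = i then r i else 0)) := by
    intro j
    split_ifs with h
    · subst h
      refine tendsto_const_nhds.congr' ?_
      filter_upwards [self_mem_nhdsWithin] with w hw
      have : w - p j ≠ 0 := sub_ne_zero.2 hw
      field_simp
    · have hne : p i - p j ≠ 0 := sub_ne_zero.2 fun h' => h (hp h').symm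
      have : ContinuousAt (fun w => (w - p i) * (r j / (w - p j))) (p i) := by
        refine ContinuousAt.mul (by fun_prop) (continuousAt_const.div (by fun_prop) hne)
      simpa using this.tendsto.mono_left nhdsWithin_le_nhds
  have := tendsto_finsetSum Finset.univ fun j _ => h1 j
  simpa [Finset.mul_sum] using this

/-- Subtracting the principal parts of its simple poles makes a function holomorphic. -/
theorem exists_differentiableOn_sub_polarPart (hp : Function.Injective p) {U : Set ℂ}
    (hU : IsOpen U) {f : ℂ → ℂ} (hf : DifferentiableOn ℂ f (U \ Set.range p))
    (hres : ∀ i, Tendsto (fun w => (w - p i) * f w) (𝓝[≠] (p i)) (𝓝 (r i))) :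
    ∃ F : ℂ → ℂ, DifferentiableOn ℂ F U ∧ ∀ w ∉ Set.range p, F w = f w - polarPart p r w := by
  classical
  set g : ℂ → ℂ := fun w => f w - polarPart p r w with hg
  have hclosed : ∀ T ⊆ Set.range p, IsClosed T := fun T hT => ((Set.finite_range p).subset hT).isClosed
  have hgd : DifferentiableOn ℂ g (U \ Set.range p) := hf.sub fun w hw =>
    (differentiableAt_polarPart hw.2).differentiableWithinAt
  set F : ℂ → ℂ := fun w => if w ∈ Set.range p then limUnder (𝓝[≠] w) g else g w with hF
  have hFg : ∀ w ∉ Set.range p, F w = g w := fun w hw => if_neg hw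
  refine ⟨F, fun x hx => ?_, hFg⟩
  refine DifferentiableAt.differentiableWithinAt ?_
  by_cases hxp : x ∈ Set.range p
  · obtain ⟨i, rfl⟩ := hxp
    -- All other poles are removed, so `p i` is the only possible singularity in `V`.
    set V := U \ (Set.range p \ {p i}) with hV
    have hVn : V ∈ 𝓝 (p i) :=
      (hU.sdiff (hclosed _ Set.sdiff_subset)).mem_nhds ⟨hx, fun h => h.2 rfl⟩
    have hVsub : V \ {p i} ⊆ U \ Set.range p := fun w hw =>
      ⟨hw.1.1, fun h => hw.1.2 ⟨h, hw.2⟩⟩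
    -- The residues of `f` and of the polar part cancel, which is the hypothesis of Riemann's
    -- removable singularity theorem.
    have ho : (fun z => g z - g (p i)) =o[𝓝[≠] (p i)] fun z => (z - p i)⁻¹ := by
      have hid : Tendsto (fun z : ℂ => z - p i) (𝓝[≠] (p i)) (𝓝 0) := by
        have : ContinuousAt (fun z : ℂ => z - p i) (p i) := by fun_prop
        simpa using this.tendsto.mono_left nhdsWithin_le_nhds
      rw [Asymptotics.isLittleO_iff_tendsto']
      · have h1 := ((hres i).sub (tendsto_sub_mul_polarPart (r := r) hp i)).sub
          (hid.mul_const (g (p i)))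
        rw [sub_self, zero_mul, sub_zero] at h1
        refine h1.congr fun z => ?_
        rw [div_inv_eq_mul, hg]; ring
      · filter_upwards [self_mem_nhdsWithin] with z hz h
        exact absurd (inv_eq_zero.1 h) (sub_ne_zero.2 hz)
    have hup := differentiableOn_update_limUnder_of_isLittleO hVn (hgd.mono hVsub) ho
    refine (hup.differentiableAt hVn).congr_of_eventuallyEq ?_
    filter_upwards [hVn] with w hw
    by_cases hwi : w = p i
    · subst hwi; simp [hF]
    · rw [Function.update_of_ne hwi, hFg w fun h => hw.2 ⟨h, hwi⟩]
  · have hn : U \ Set.range p ∈ 𝓝 x := (hU.sdiff (hclosed _ subset_rfl)).mem_nhds ⟨hx, hxp⟩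
    refine (hgd.differentiableAt hn).congr_of_eventuallyEq ?_
    filter_upwards [hn] with w hw using hFg w hw.2

/-- A piecewise meromorphic function with simple poles off `Σ` and jump contour `Σ`, together
with its values `a` at infinity and coefficient `B` at the origin. -/
structure IsPiecewiseMeromorphic (q0 : ℝ) (p r : ι → ℂ) (a B : ℂ) (f fp fm : ℂ → ℂ) : Prop where
  injective : Function.Injective p
  notMem : ∀ i, p i ∉ Sigma q0
  differentiableOn : DifferentiableOn ℂ f (Sigma q0 ∪ Set.range p)ᶜ
  residue : ∀ i, Tendsto (fun w => (w - p i) * f w) (𝓝[≠] (p i)) (𝓝 (r i))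
  plus : ∀ ξ ∈ Sigma q0, ξ ≠ 0 → ξ ^ 4 ≠ (q0 : ℂ) ^ 4 → Tendsto f (𝓝[Dplus q0] ξ) (𝓝 (fp ξ))
  minus : ∀ ξ ∈ Sigma q0, ξ ≠ 0 → ξ ^ 4 ≠ (q0 : ℂ) ^ 4 → Tendsto f (𝓝[Dminus q0] ξ) (𝓝 (fm ξ))
  nodes : ∀ ξ : ℂ, ξ ^ 4 = (q0 : ℂ) ^ 4 → f =O[𝓝[(Sigma q0)ᶜ] ξ] (fun _ => (1 : ℂ))
  infinity : Tendsto f (Bornology.cobounded ℂ ⊓ 𝓟 (Sigma q0)ᶜ) (𝓝 a)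
  zero : Tendsto (fun ξ => ξ * f ξ) (𝓝[(Sigma q0)ᶜ] 0) (𝓝 B)

/-- The polar part is continuous on `Σ`, vanishes at infinity and is regular at the origin.
Subtracting it therefore affects neither the jump nor `a` nor `B`. -/
lemma IsPiecewiseMeromorphic.exists_holomorphic {q0 : ℝ} (hq0 : 0 < q0) {a B : ℂ}
    {f fp fm : ℂ → ℂ} (h : IsPiecewiseMeromorphic q0 p r a B f fp fm) :
    ∃ F : ℂ → ℂ, (∀ w ∉ Set.range p, F w = f w - polarPart p r w) ∧
      IsPiecewiseHolomorphic q0 F (fun ξ => fp ξ - polarPart p r ξ)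
        (fun ξ => fm ξ - polarPart p r ξ) ∧
      Tendsto F (Bornology.cobounded ℂ ⊓ 𝓟 (Sigma q0)ᶜ) (𝓝 a) ∧
      Tendsto (fun ξ => ξ * F ξ) (𝓝[(Sigma q0)ᶜ] 0) (𝓝 B) := by
  obtain ⟨F, hF, hFf⟩ := exists_differentiableOn_sub_polarPart h.injective
    (isClosed_Sigma q0).isOpen_compl
    (h.differentiableOn.mono (by rw [Set.compl_union, Set.sdiff_eq_compl_inter, Set.inter_comm]))
    h.residue
  have hrange : ∀ ξ ∈ Sigma q0, ξ ∉ Set.range p := by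
    rintro _ hξ ⟨i, rfl⟩; exact h.notMem i hξ
  have hopen : IsOpen (Set.range p)ᶜ := (Set.finite_range p).isClosed.isOpen_compl
  have hev : ∀ ξ ∈ Sigma q0, ∀ T : Set ℂ, (fun w => f w - polarPart p r w) =ᶠ[𝓝[T] ξ] F :=
    fun ξ hξ T => by
      filter_upwards [nhdsWithin_le_nhds (hopen.mem_nhds (hrange ξ hξ))] with w hw
      exact (hFf w hw).symm
  have hpol : ∀ ξ ∈ Sigma q0, ∀ T : Set ℂ,
      Tendsto (polarPart p r) (𝓝[T] ξ) (𝓝 (polarPart p r ξ)) := fun ξ hξ T =>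
    (differentiableAt_polarPart (hrange ξ hξ)).continuousAt.tendsto.mono_left nhdsWithin_le_nhds
  refine ⟨F, hFf, ⟨hF, fun ξ h1 h2 h3 => ?_, fun ξ h1 h2 h3 => ?_, fun ξ h4 => ?_⟩, ?_, ?_⟩
  · exact ((h.plus ξ h1 h2 h3).sub (hpol ξ h1 _)).congr' (hev ξ h1 _)
  · exact ((h.minus ξ h1 h2 h3).sub (hpol ξ h1 _)).congr' (hev ξ h1 _)
  · have h1 := node_mem_Sigma hq0 h4
    exact ((h.nodes ξ h4).sub ((hpol ξ h1 _).isBigO_one ℂ)).congr' (hev ξ h1 _) EventuallyEq.rfl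
  · have h1 := h.infinity.sub (tendsto_polarPart_cobounded (p := p) (r := r) |>.mono_left inf_le_left)
    rw [sub_zero] at h1
    refine h1.congr' ?_
    have : (Set.range p)ᶜ ∈ Bornology.cobounded ℂ :=
      Bornology.isBounded_def.1 (Set.finite_range p).isBounded
    filter_upwards [mem_inf_of_left this] with w hw using (hFf w hw).symm
  · have h0 : (0 : ℂ) ∈ Sigma q0 := Or.inl zero_im
    have hid : Tendsto (fun ξ : ℂ => ξ) (𝓝[(Sigma q0)ᶜ] 0) (𝓝 0) :=
      tendsto_id.mono_left nhdsWithin_le_nhds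
    have h1 := h.zero.sub (hid.mul (hpol 0 h0 (Sigma q0)ᶜ))
    rw [zero_mul, sub_zero] at h1
    refine h1.congr' ?_
    filter_upwards [hev 0 h0 (Sigma q0)ᶜ] with w hw
    rw [← hw]; ring

/-- Without a jump, a piecewise meromorphic function is rational. -/
theorem IsPiecewiseMeromorphic.eq_rational {q0 : ℝ} (hq0 : 0 < q0) {a B : ℂ}
    {f fp fm : ℂ → ℂ} (h : IsPiecewiseMeromorphic q0 p r a B f fp fm)
    (hjump : ∀ ξ ∈ Sigma q0, ξ ≠ 0 → ξ ^ 4 ≠ (q0 : ℂ) ^ 4 → fp ξ = fm ξ)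
    {z : ℂ} (hz : z ∉ Sigma q0) (hzp : z ∉ Set.range p) :
    f z = a + B / z + ∑ i, r i / (z - p i) := by
  classical
  -- The boundary functions are unconstrained at the origin and at the nodes. Redefining one of them
  -- there makes the jump vanish identically on `Σ`.
  set gm : ℂ → ℂ := fun ξ => if ξ ≠ 0 ∧ ξ ^ 4 ≠ (q0 : ℂ) ^ 4 then fm ξ else fp ξ with hgm
  have h' : IsPiecewiseMeromorphic q0 p r a B f fp gm :=
    { h with
      minus := fun ξ h1 h2 h3 => by
        have : gm ξ = fm ξ := if_pos ⟨h2, h3⟩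
        rw [this]; exact h.minus ξ h1 h2 h3 }
  obtain ⟨F, hFf, hF, hinf, h0⟩ := h'.exists_holomorphic hq0
  have hzero : ∀ ξ ∈ Sigma q0, fp ξ - polarPart p r ξ - (gm ξ - polarPart p r ξ) = 0 := by
    intro ξ hξ
    simp only [hgm]
    split_ifs with hc
    · rw [hjump ξ hξ hc.1 hc.2]; ring
    · ring
  have h1 := hF.eq_cauchy hq0 hinf h0 (by
    simp only [hzero _ (real_mem_Sigma q0 _)]; exact integrable_zero _ _ _) hz
  simp only [sigmaIntegral, hzero _ (real_mem_Sigma q0 _), hzero _ (circPt_mem_Sigma hq0 _),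
    zero_div, zero_mul, integral_zero, intervalIntegral.integral_zero] at h1
  rw [hFf z hzp] at h1
  have h2 : f z = a + B / z + polarPart p r z := by linear_combination h1
  exact h2

/-- The `1 / z` coefficient of a piecewise meromorphic function along the imaginary axis. -/
theorem IsPiecewiseMeromorphic.tendsto_coeff {q0 : ℝ} (hq0 : 0 < q0) {a B : ℂ}
    {f fp fm g : ℂ → ℂ} (h : IsPiecewiseMeromorphic q0 p r a B f fp fm)
    (hjump : ∀ ξ ∈ Sigma q0, ξ ≠ 0 → ξ ^ 4 ≠ (q0 : ℂ) ^ 4 → fp ξ = fm ξ - g ξ)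
    (hg : SigmaIntegrable q0 g) :
    Tendsto (fun y : ℝ => (y * I : ℂ) * (f (y * I) - a)) atTop
      (𝓝 (B + (∑ i, r i) + 1 / (2 * Real.pi * I) * sigmaIntegral q0 g)) := by
  -- This agrees with `fp` wherever a boundary value is prescribed, and its jump is `-g` at every
  -- point.
  set gp : ℂ → ℂ := fun ξ => fm ξ - g ξ with hgp
  have h' : IsPiecewiseMeromorphic q0 p r a B f gp fm :=
    { h with
      plus := fun ξ h1 h2 h3 => by
        have : gp ξ = fp ξ := (hjump ξ h1 h2 h3).symm
        rw [this]; exact h.plus ξ h1 h2 h3 }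
  obtain ⟨F, hFf, hF, hinf, h0⟩ := h'.exists_holomorphic hq0
  have hsub : ∀ ξ, gp ξ - polarPart p r ξ - (fm ξ - polarPart p r ξ) = -g ξ := fun ξ => by
    simp only [hgp]; ring
  have h1 := hF.tendsto_coeff hq0 hinf h0 (by
    simp only [hsub]; exact ⟨hg.1.neg, hg.2.neg⟩)
  have hneg : sigmaIntegral q0 (fun ξ => -g ξ) = -sigmaIntegral q0 g := by
    simp only [sigmaIntegral, neg_mul, integral_neg, intervalIntegral.integral_neg]; ring
  simp only [hsub, hneg] at h1
  have h2 := h1.add (tendsto_mul_polarPart_imaginary (p := p) (r := r))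
  have h3 : B - 1 / (2 * Real.pi * I) * -sigmaIntegral q0 g + ∑ i, r i =
      B + (∑ i, r i) + 1 / (2 * Real.pi * I) * sigmaIntegral q0 g := by ring
  rw [h3] at h2
  refine h2.congr' ?_
  have hcob : Tendsto (fun y : ℝ => (y * I : ℂ)) atTop (Bornology.cobounded ℂ) := by
    rw [← tendsto_norm_atTop_iff_cobounded]
    simpa using tendsto_abs_atTop_atTop
  have hr : (Set.range p)ᶜ ∈ Bornology.cobounded ℂ :=
    Bornology.isBounded_def.1 (Set.finite_range p).isBounded
  filter_upwards [hcob hr] with y hy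
  rw [hFf _ hy]; ring

end polarPart

/-! ### Large-`z` asymptotics from the scattering problem -/

/-- A linear equation with strong damping forces its solution to follow the forcing term. -/
lemma norm_le_of_damped {y a x ε : ℝ} (hax : a ≤ x) (hy : 0 < y) {f g : ℝ → ℂ} {c : ℂ}
    (hf : ∀ s, HasDerivAt f (-y * f s + g s) s) (hg : ∀ s ∈ Set.Icc a x, ‖g s - c‖ ≤ ε) :
    ‖y * f x - c‖ ≤ Real.exp (-(y * (x - a))) * ‖y * f a - c‖ + ε := by
  -- With the integrating factor `e^{ys}` the damping disappears: `v' = y e^{ys} (g - c)`, whose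
  -- norm is at most the derivative of `ε e^{ys}`.
  set v : ℝ → ℂ := fun s => (Real.exp (y * s) : ℂ) * (y * f s - c) with hv
  have hexp : ∀ s : ℝ, HasDerivAt (fun s : ℝ => Real.exp (y * s)) (y * Real.exp (y * s)) s := by
    intro s
    have h1 : HasDerivAt (fun s : ℝ => y * s) y s := by
      simpa using (hasDerivAt_id s).const_mul y
    simpa [mul_comm] using h1.exp
  have hvd : ∀ s, HasDerivAt v ((Real.exp (y * s) : ℂ) * y * (g s - c)) s := by
    intro s
    have h1 := (hexp s).ofReal_comp.mul (((hf s).const_mul (y : ℂ)).sub_const c)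
    refine h1.congr_deriv ?_
    push_cast; ring
  have hB : ∀ s, HasDerivAt
      (fun s => ‖v a‖ + ε * (Real.exp (y * s) - Real.exp (y * a))) (ε * (y * Real.exp (y * s))) s :=
    fun s => (((hexp s).sub_const _).const_mul ε).const_add _
  have hε : 0 ≤ ε := (norm_nonneg _).trans (hg a ⟨le_rfl, hax⟩)
  have h1 := image_norm_le_of_norm_deriv_right_le_deriv_boundary (f := v) (a := a) (b := x)
    (fun s _ => (hvd s).continuousAt.continuousWithinAt)
    (fun s _ => (hvd s).hasDerivWithinAt) (B := fun s => ‖v a‖ + ε * (Real.exp (y * s) -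
      Real.exp (y * a))) (by simp) hB
    (fun s hs => by
      rw [norm_mul, norm_mul, norm_real, norm_real, Real.norm_eq_abs, Real.norm_eq_abs,
        Real.abs_exp, abs_of_pos hy]
      have := hg s ⟨hs.1, hs.2.le⟩
      have h0 : 0 ≤ Real.exp (y * s) * y := by positivity
      nlinarith [mul_le_mul_of_nonneg_left this h0]) (Set.right_mem_Icc.2 hax)
  simp only [hv, norm_mul, norm_real, Real.norm_eq_abs, Real.abs_exp] at h1
  have hx := Real.exp_pos (y * x)
  have ha := Real.exp_pos (y * a)
  have h2 : Real.exp (-(y * (x - a))) * Real.exp (y * x) = Real.exp (y * a) := by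
    rw [← Real.exp_add]; congr 1; ring
  refine le_of_mul_le_mul_left ?_ hx
  rw [mul_add, ← mul_assoc, mul_comm (Real.exp (y * x)) (Real.exp (-(y * (x - a)))), h2]
  nlinarith [mul_nonneg hε ha.le]

/-- Energy estimate for the third column of `M` on the positive imaginary axis. -/
lemma energy_le {κ y : ℝ} (hy : 0 ≤ y) (hκ : κ ≤ 1) {q : ℝ → Fin 2 → ℂ} {u : ℝ → Fin 3 → ℂ}
    (h0 : ∀ s, HasDerivAt (fun s => u s 0) (-y * u s 0 + q s 0 * u s 2) s)
    (h1 : ∀ s, HasDerivAt (fun s => u s 1) (-y * u s 1 + q s 1 * u s 2) s)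
    (h2 : ∀ s, HasDerivAt (fun s => u s 2)
      (κ * u s 2 - (conj (q s 0) * u s 0 + conj (q s 1) * u s 1)) s) {a s : ℝ} (has : a ≤ s) :
    ‖u s 0‖ ^ 2 + ‖u s 1‖ ^ 2 + ‖u s 2‖ ^ 2 ≤
      Real.exp (2 * (s - a)) * (‖u a 0‖ ^ 2 + ‖u a 1‖ ^ 2 + ‖u a 2‖ ^ 2) := by
  set E : ℝ → ℝ := fun s => ‖u s 0‖ ^ 2 + ‖u s 1‖ ^ 2 + ‖u s 2‖ ^ 2 with hE
  have hd : ∀ s, HasDerivAt E (-2 * y * (‖u s 0‖ ^ 2 + ‖u s 1‖ ^ 2) + 2 * κ * ‖u s 2‖ ^ 2) s := by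
    intro s
    have := ((h0 s).norm_sq.add (h1 s).norm_sq).add (h2 s).norm_sq
    refine this.congr_deriv ?_
    -- The terms with `q` cancel because `Q` is skew-Hermitian, so no bound on `q` enters the
    -- estimate.
    simp only [Complex.inner, ← Complex.normSq_eq_norm_sq, Complex.normSq_apply]
    simp
    ring
  have hexp : ∀ s : ℝ, HasDerivAt (fun s : ℝ => Real.exp (-2 * s)) (-2 * Real.exp (-2 * s)) s := by
    intro s
    have h1 : HasDerivAt (fun s : ℝ => -2 * s) (-2) s := by
      simpa using (hasDerivAt_id s).const_mul (-2 : ℝ)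
    simpa [mul_comm] using h1.exp
  -- Since `y ≥ 0` and `κ ≤ 1`, the energy satisfies `E' ≤ 2E`.
  have hanti : Antitone (fun s => Real.exp (-2 * s) * E s) := by
    have hm := fun s => (hexp s).fun_mul (hd s)
    refine antitone_of_deriv_nonpos (fun s => (hm s).differentiableAt) fun s => ?_
    rw [(hm s).deriv]
    have := Real.exp_pos (-2 * s)
    have h3 : -2 * E s + (-2 * y * (‖u s 0‖ ^ 2 + ‖u s 1‖ ^ 2) + 2 * κ * ‖u s 2‖ ^ 2) ≤ 0 := by
      simp only [hE]
      nlinarith [sq_nonneg ‖u s 0‖, sq_nonneg ‖u s 1‖, sq_nonneg ‖u s 2‖,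
        mul_nonneg hy (sq_nonneg ‖u s 0‖), mul_nonneg hy (sq_nonneg ‖u s 1‖),
        mul_nonneg (sub_nonneg.2 hκ) (sq_nonneg ‖u s 2‖)]
    nlinarith [mul_nonpos_of_nonneg_of_nonpos this.le h3]
  have h3 := hanti has
  simp only at h3
  have h4 := mul_le_mul_of_nonneg_left h3 (Real.exp_pos (2 * s)).le
  rw [← mul_assoc, ← mul_assoc, ← Real.exp_add, ← Real.exp_add] at h4
  rw [show 2 * s + -2 * s = 0 by ring, show 2 * s + -2 * a = 2 * (s - a) by ring, Real.exp_zero,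
    one_mul] at h4
  exact h4

/-- On the positive imaginary axis the off-diagonal entries `u_j` of the third column satisfy
`y u_j → q_j`. -/
theorem tendsto_mul_of_damped_system {κ : ℝ → ℝ} (hκ0 : ∀ᶠ y in atTop, |κ y| ≤ 1)
    {q : ℝ → Fin 2 → ℂ} (hq : Continuous q) {u : ℝ → ℝ → Fin 3 → ℂ}
    (h0 : ∀ᶠ y : ℝ in atTop, ∀ s,
      HasDerivAt (fun s => u y s 0) (-y * u y s 0 + q s 0 * u y s 2) s)
    (h1 : ∀ᶠ y : ℝ in atTop, ∀ s,
      HasDerivAt (fun s => u y s 1) (-y * u y s 1 + q s 1 * u y s 2) s)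
    (h2 : ∀ᶠ y : ℝ in atTop, ∀ s, HasDerivAt (fun s => u y s 2)
      (κ y * u y s 2 - (conj (q s 0) * u y s 0 + conj (q s 1) * u y s 1)) s)
    (hl : ∀ s, Tendsto (fun y => u y s) atTop (𝓝 ![0, 0, 1])) (x : ℝ) (j : Fin 2) :
    Tendsto (fun y : ℝ => (y : ℂ) * u y x j.castSucc) atTop (𝓝 (q x j)) := by
  have hlr : ∀ s r, Tendsto (fun y => u y s r) atTop (𝓝 ((![0, 0, 1] : Fin 3 → ℂ) r)) :=
    fun s r => tendsto_pi_nhds.1 (hl s) r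
  obtain ⟨Q, hQ⟩ : ∃ Q : ℝ, ∀ s ∈ Set.Icc (x - 1) x, ‖q s‖ ≤ Q :=
    isCompact_Icc.exists_bound_of_continuousOn hq.continuousOn
  have hQ0 : 0 ≤ Q := (norm_nonneg _).trans (hQ x ⟨by linarith, le_rfl⟩)
  have hQj : ∀ s ∈ Set.Icc (x - 1) x, ∀ i, ‖q s i‖ ≤ Q := fun s hs i =>
    (norm_le_pi_norm (q s) i).trans (hQ s hs)
  -- At `x - 1` the energy tends to `1`, so it is eventually below `2`; over a unit interval it
  -- grows by at most `e²`. As `K ≥ 1`, the bound `K` for the squares also bounds the entries.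
  set K : ℝ := Real.exp 2 * 2 with hK
  have hK1 : 1 ≤ K := by have := Real.add_one_le_exp 2; simp only [hK]; linarith
  have hbound : ∀ᶠ y : ℝ in atTop, ∀ s ∈ Set.Icc (x - 1) x, ∀ r, ‖u y s r‖ ≤ K := by
    have hE : Tendsto (fun y => ‖u y (x - 1) 0‖ ^ 2 + ‖u y (x - 1) 1‖ ^ 2 + ‖u y (x - 1) 2‖ ^ 2)
        atTop (𝓝 1) := by
      have := (((hlr (x - 1) 0).norm.pow 2).add ((hlr (x - 1) 1).norm.pow 2)).add
        ((hlr (x - 1) 2).norm.pow 2)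
      simpa using this
    filter_upwards [h0, h1, h2, hκ0, eventually_ge_atTop 0,
      hE.eventually (gt_mem_nhds one_lt_two)] with y h0 h1 h2 hκ hy hEy s hs r
    have h3 := energy_le hy ((le_abs_self _).trans hκ) h0 h1 h2 hs.1
    have h4 : Real.exp (2 * (s - (x - 1))) ≤ Real.exp 2 :=
      Real.exp_le_exp.2 (by linarith [hs.2])
    have h5 : ‖u y s 0‖ ^ 2 + ‖u y s 1‖ ^ 2 + ‖u y s 2‖ ^ 2 ≤ K :=
      h3.trans (mul_le_mul h4 hEy.le (by positivity) (Real.exp_pos _).le)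
    have h6 : ‖u y s r‖ ^ 2 ≤ K := by
      have a0 := sq_nonneg ‖u y s 0‖
      have a1 := sq_nonneg ‖u y s 1‖
      have a2 := sq_nonneg ‖u y s 2‖
      fin_cases r <;> simp only [Fin.zero_eta, Fin.mk_one, Fin.reduceFinMk] <;> linarith
    nlinarith [norm_nonneg (u y s r)]
  -- A Lipschitz constant for the third entry, uniform in `y`: the large coefficient `y` does not
  -- occur in its equation.
  set C : ℝ := K + 2 * Q * K with hC
  have hvar : ∀ᶠ y : ℝ in atTop, ∀ s ∈ Set.Icc (x - 1) x, ‖u y s 2 - u y x 2‖ ≤ C * (x - s) := by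
    filter_upwards [h2, hbound, hκ0] with y h2 hb hκ s hs
    have h3 := (convex_Icc (x - 1) x).norm_image_sub_le_of_norm_hasDerivWithin_le (C := C)
      (fun v _ => (h2 v).hasDerivWithinAt) (fun v hv => ?_) ⟨by linarith, le_rfl⟩ hs
    · rwa [Real.norm_eq_abs, abs_sub_comm, abs_of_nonneg (by linarith [hs.2])] at h3
    · have b0 := mul_le_mul (hQj v hv 0) (hb v hv 0) (norm_nonneg _) hQ0
      have b1 := mul_le_mul (hQj v hv 1) (hb v hv 1) (norm_nonneg _) hQ0
      have b2 := mul_le_mul hκ (hb v hv 2) (norm_nonneg _) zero_le_one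
      have b3 := norm_sub_le (κ y * u y v 2 : ℂ)
        (conj (q v 0) * u y v 0 + conj (q v 1) * u y v 1)
      have b4 := norm_add_le (conj (q v 0) * u y v 0) (conj (q v 1) * u y v 1)
      rw [norm_mul, norm_mul, RCLike.norm_conj, RCLike.norm_conj] at b4
      rw [norm_mul, norm_real, Real.norm_eq_abs] at b3
      simp only [hC]
      linarith
  have hC0 : 0 ≤ C := by have : 0 ≤ Q * K := mul_nonneg hQ0 (by linarith); simp only [hC]; linarith
  have hj : ∀ᶠ y : ℝ in atTop, ∀ s, HasDerivAt (fun s => u y s j.castSucc)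
      (-y * u y s j.castSucc + q s j * u y s 2) s := by
    fin_cases j
    · exact h0
    · exact h1
  rw [Metric.tendsto_nhds]
  intro ε hε
  -- a short interval on which the forcing term is almost constant
  obtain ⟨δ, hδ0, hδ1, hδC, hδq⟩ : ∃ δ > 0, δ ≤ 1 ∧ Q * (C * δ) ≤ ε / 8 ∧
      ∀ s ∈ Set.Icc (x - δ) x, ‖q s j - q x j‖ ≤ ε / 8 := by
    have hqj : Continuous fun s => q s j := (continuous_apply j).comp hq
    obtain ⟨δ₁, hδ₁, h⟩ := Metric.continuous_iff.1 hqj x (ε / 8) (by positivity)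
    refine ⟨min (min (δ₁ / 2) 1) (ε / 8 / (Q * C + 1)), by positivity,
      (min_le_left _ _).trans (min_le_right _ _), ?_, fun s hs => ?_⟩
    · have h3 := min_le_right (min (δ₁ / 2) 1) (ε / 8 / (Q * C + 1))
      have h4 : 0 < Q * C + 1 := by positivity
      rw [le_div_iff₀ h4] at h3
      have h5 : 0 < min (min (δ₁ / 2) 1) (ε / 8 / (Q * C + 1)) := by positivity
      nlinarith
    · have h3 := (min_le_left (min (δ₁ / 2) 1) (ε / 8 / (Q * C + 1))).trans (min_le_left _ _)
      have h4 := h s (by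
        rw [Real.dist_eq, abs_sub_comm, abs_of_nonneg (by linarith [hs.2])]
        linarith [hs.1])
      rw [dist_eq_norm] at h4
      exact h4.le
  have hu2 : ∀ᶠ y : ℝ in atTop, Q * ‖u y x 2 - 1‖ < ε / 8 := by
    have h3 : Tendsto (fun y => Q * ‖u y x 2 - 1‖) atTop (𝓝 (Q * ‖(1 : ℂ) - 1‖)) :=
      ((hlr x 2).sub_const 1).norm.const_mul Q
    rw [sub_self, norm_zero, mul_zero] at h3
    exact h3.eventually (gt_mem_nhds (by positivity))
  have hdecay : Tendsto (fun y : ℝ => Real.exp (-(y * δ)) * (y * K + ‖q x j‖)) atTop (𝓝 0) := by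
    have h3 := Real.tendsto_pow_mul_exp_neg_atTop_nhds_zero 1
    have h4 := Real.tendsto_pow_mul_exp_neg_atTop_nhds_zero 0
    have h5 : Tendsto (fun y : ℝ => y * δ) atTop atTop := tendsto_id.atTop_mul_const hδ0
    have h6 := ((h3.comp h5).const_mul (K / δ)).add ((h4.comp h5).const_mul ‖q x j‖)
    rw [mul_zero, mul_zero, add_zero] at h6
    refine h6.congr fun y => ?_
    simp only [Function.comp, pow_one, pow_zero]
    field_simp
  filter_upwards [hj, hbound, hvar, hu2, eventually_gt_atTop 0,
    hdecay.eventually (gt_mem_nhds (by positivity : (0 : ℝ) < ε / 8))] with y hj hb hv hu hy hdec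
  have hsub : ∀ s ∈ Set.Icc (x - δ) x, s ∈ Set.Icc (x - 1) x := fun s hs =>
    ⟨by linarith [hs.1], hs.2⟩
  have hforce : ∀ s ∈ Set.Icc (x - δ) x, ‖q s j * u y s 2 - q x j‖ ≤ ε / 2 := by
    intro s hs
    -- The three terms measure the variation of the third entry, its distance from `1` at `x`, and
    -- the variation of `q`; each is at most `ε/8`.
    have e1 : q s j * u y s 2 - q x j =
        q s j * (u y s 2 - u y x 2) + q s j * (u y x 2 - 1) + (q s j - q x j) := by ring
    rw [e1]
    refine (norm_add₃_le).trans ?_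
    rw [norm_mul, norm_mul]
    have f1 := mul_le_mul (hQj s (hsub s hs) j) (hv s (hsub s hs)) (norm_nonneg _) hQ0
    have f2 := mul_le_mul_of_nonneg_right (hQj s (hsub s hs) j) (norm_nonneg (u y x 2 - 1))
    have f3 := hδq s hs
    have f4 : Q * (C * (x - s)) ≤ Q * (C * δ) := by
      have : x - s ≤ δ := by linarith [hs.1]
      gcongr
    linarith
  have hmain := norm_le_of_damped (a := x - δ) (by linarith) hy hj hforce
  rw [dist_eq_norm]
  -- The error at the left endpoint grows at most linearly in `y` and is suppressed by `e^{-yδ}`.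
  -- The total is below `ε/8 + ε/2`.
  have h3 : ‖(y : ℂ) * u y (x - δ) j.castSucc - q x j‖ ≤ y * K + ‖q x j‖ := by
    refine (norm_sub_le _ _).trans ?_
    rw [norm_mul, norm_real, Real.norm_eq_abs, abs_of_pos hy]
    have := hb (x - δ) ⟨by linarith, by linarith⟩ j.castSucc
    gcongr
  have h4 := mul_le_mul_of_nonneg_left h3 (Real.exp_pos (-(y * (x - (x - δ))))).le
  rw [show x - (x - δ) = δ by ring] at h4 hmain
  linarith

/-! ### The scattering problem on the imaginary axis. -/

lemma DiscreteData.finite_poles {q0 : ℝ} {N₁ N₂ N₃ : ℕ} (S : DiscreteData q0 N₁ N₂ N₃)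
    (c : Fin 3) : (S.poles c).Finite := by
  have hr : ∀ {n : ℕ} (f : Fin n → ℂ), {w | ∃ i, w = f i}.Finite := fun f => by
    have : {w | ∃ i, w = f i} = Set.range f := by ext w; simp [eq_comm]
    rw [this]; exact Set.finite_range f
  fin_cases c
  · exact (hr _).union ((hr _).union ((hr _).union (hr _)))
  · exact (hr _).union ((hr _).union ((hr _).union (hr _)))
  · exact (hr _).union ((hr _).union ((hr _).union (hr _)))

lemma tendsto_imaginary {q0 : ℝ} (hq0 : 0 < q0) :
    Tendsto (fun y : ℝ => (y * I : ℂ)) atTop (Bornology.cobounded ℂ ⊓ 𝓟 (Sigma q0)ᶜ) := by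
  refine tendsto_inf.2 ⟨?_, tendsto_principal.2 ?_⟩
  · rw [← tendsto_norm_atTop_iff_cobounded]
    simpa using tendsto_abs_atTop_atTop
  · filter_upwards [eventually_gt_atTop q0] with y hy
    have hy0 : 0 < y := hq0.trans hy
    rintro (h | h)
    · simp at h; exact hy0.ne' h
    · simp [abs_of_pos hy0] at h; exact hy.ne' h

/-- The potential is read off from the third column of `M` on the imaginary axis. -/
theorem IsPotentialOf.tendsto {q0 : ℝ} (hq0 : 0 < q0) {N₁ N₂ N₃ : ℕ} {qp : Fin 2 → ℂ}
    {S : DiscreteData q0 N₁ N₂ N₃} {M : ℝ → ℝ → ℂ → Matrix (Fin 3) (Fin 3) ℂ}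
    {q : ℝ → ℝ → Fin 2 → ℂ} (hq : ∀ t, Continuous fun x => q x t)
    (hinf : ∀ x t, Tendsto (M x t) (Bornology.cobounded ℂ ⊓ 𝓟 (Sigma q0)ᶜ) (𝓝 (Minf q0 qp)))
    (hLax : IsPotentialOf S M q) (x t : ℝ) (j : Fin 2) :
    Tendsto (fun y : ℝ => (y * I : ℂ) * M x t (y * I) j.castSucc 2) atTop
      (𝓝 (I * q x t j)) := by
  have hcob := tendsto_imaginary hq0
  have hgood : ∀ᶠ y : ℝ in atTop, 0 < y ∧ (y * I : ℂ) ∉ Sigma q0 ∧ ∀ c, (y * I : ℂ) ∉ S.poles c := by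
    have h1 : ∀ᶠ y : ℝ in atTop, (y * I : ℂ) ∉ Sigma q0 :=
      hcob (mem_inf_of_right (mem_principal_self _))
    have h2 : ∀ᶠ y : ℝ in atTop, ∀ c, (y * I : ℂ) ∉ S.poles c := by
      rw [eventually_all]
      intro c
      exact hcob (mem_inf_of_left (Bornology.isBounded_def.1 (S.finite_poles c).isBounded))
    filter_upwards [h1, h2, eventually_gt_atTop 0] with y h1 h2 h3 using ⟨h3, h1, h2⟩
  -- Removing the factor `e^{-iθ₁}` from the third column of `Φ` adds `iλ` to the coefficient.
  have hder : ∀ᶠ y : ℝ in atTop, ∀ s r, HasDerivAt (fun s => M s t (y * I) r 2)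
      ((laxU q0 (q s t) (y * I) * M s t (y * I)) r 2 +
        I * lamOf q0 (y * I) * M s t (y * I) r 2) s := by
    filter_upwards [hgood] with y hy s r
    have h1 := hLax t (y * I) hy.2.1 hy.2.2 s r 2
    have hθ : HasDerivAt (fun s : ℝ => exp (I * theta1 q0 s t (y * I)))
        (exp (I * theta1 q0 s t (y * I)) * (I * lamOf q0 (y * I))) s := by
      have h2 : HasDerivAt (fun s : ℝ => I * theta1 q0 s t (y * I)) (I * lamOf q0 (y * I)) s := by
        unfold theta1
        have := (((hasDerivAt_id s).ofReal_comp.add_const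
          (2 * (2 * kOf q0 (y * I) ^ 2 - (q0 : ℂ) ^ 2) * t)).const_mul (lamOf q0 (y * I))).const_mul I
        simpa using this
      exact h2.cexp
    have h2 := h1.mul hθ
    have hent : ∀ (A : Matrix (Fin 3) (Fin 3) ℂ) (s : ℝ), (A * expPhase q0 s t (y * I)) r 2 =
        A r 2 * exp (-(I * theta1 q0 s t (y * I))) := by
      intro A s
      simp [expPhase, Matrix.mul_diagonal]
    have hcancel : ∀ s : ℝ, exp (-(I * theta1 q0 s t (y * I))) * exp (I * theta1 q0 s t (y * I))
        = 1 := fun s => by rw [← Complex.exp_add, neg_add_cancel, Complex.exp_zero]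
    simp only [← Matrix.mul_assoc, hent] at h2
    have h3 : (fun s => M s t (y * I) r 2) = fun s : ℝ => M s t (y * I) r 2 *
        exp (-(I * theta1 q0 s t (y * I))) * exp (I * theta1 q0 s t (y * I)) := by
      ext s; rw [mul_assoc, hcancel, mul_one]
    rw [h3]
    refine h2.congr_deriv ?_
    linear_combination ((laxU q0 (q s t) (y * I) * M s t (y * I)) r 2 +
      I * lamOf q0 (y * I) * M s t (y * I) r 2) * hcancel s
  -- At `z = iy` one has `ik + iλ = -y` and `-ik + iλ = q₀²/y`.
  have hmain := tendsto_mul_of_damped_system (κ := fun y => q0 ^ 2 / y)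
    (q := fun s => q s t) (u := fun y s r => M s t (y * I) r 2) ?_ (hq t) ?_ ?_ ?_ ?_ x j
  · have h1 := hmain.const_mul I
    refine h1.congr fun y => ?_
    ring
  · filter_upwards [eventually_ge_atTop (q0 ^ 2), eventually_gt_atTop 0] with y hy hy0
    rw [abs_of_nonneg (by positivity), div_le_one hy0]
    exact hy
  · filter_upwards [hder, hgood] with y hy hg s
    have hy0 : (y : ℂ) ≠ 0 := by exact_mod_cast hg.1.ne'
    refine (hy s 0).congr_deriv ?_
    simp [laxU, Qmat, sigma3, Matrix.mul_apply, Fin.sum_univ_three, lamOf, kOf]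
    field_simp
    ring_nf
    simp
    ring
  · filter_upwards [hder, hgood] with y hy hg s
    have hy0 : (y : ℂ) ≠ 0 := by exact_mod_cast hg.1.ne'
    refine (hy s 1).congr_deriv ?_
    simp [laxU, Qmat, sigma3, Matrix.mul_apply, Fin.sum_univ_three, lamOf, kOf]
    field_simp
    ring_nf
    simp
    ring
  · filter_upwards [hder, hgood] with y hy hg s
    have hy0 : (y : ℂ) ≠ 0 := by exact_mod_cast hg.1.ne'
    refine (hy s 2).congr_deriv ?_
    simp [laxU, Qmat, sigma3, Matrix.mul_apply, Fin.sum_univ_three, lamOf, kOf]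
    field_simp
    ring
  · intro s
    have h1 := (hinf s t).comp hcob
    rw [tendsto_pi_nhds]
    intro r
    have h2 := tendsto_pi_nhds.1 (tendsto_pi_nhds.1 h1 r) 2
    have h3 : (![0, 0, 1] : Fin 3 → ℂ) r = Minf q0 qp r 2 := by fin_cases r <;> simp [Minf]
    rw [h3]
    exact h2

/-! ### Location of the poles -/

section regions

variable {q0 : ℝ}

lemma disjoint_D1_D2 : Disjoint (D1 q0) (D2 q0) :=
  Set.disjoint_left.2 fun _ h h' => lt_asymm h.2 h'.2
lemma disjoint_D1_D3 : Disjoint (D1 q0) (D3 q0) :=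
  Set.disjoint_left.2 fun _ h h' => lt_asymm h.1 h'.1
lemma disjoint_D1_D4 : Disjoint (D1 q0) (D4 q0) :=
  Set.disjoint_left.2 fun _ h h' => lt_asymm h.1 h'.1
lemma disjoint_D2_D3 : Disjoint (D2 q0) (D3 q0) :=
  Set.disjoint_left.2 fun _ h h' => lt_asymm h.1 h'.1
lemma disjoint_D2_D4 : Disjoint (D2 q0) (D4 q0) :=
  Set.disjoint_left.2 fun _ h h' => lt_asymm h.1 h'.1
lemma disjoint_D3_D4 : Disjoint (D3 q0) (D4 q0) :=
  Set.disjoint_left.2 fun _ h h' => lt_asymm h.2 h'.2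

lemma conj_mem_D2 {z : ℂ} (h : z ∈ D1 q0) : conj z ∈ D2 q0 :=
  ⟨by simpa using h.1, by simpa using h.2⟩

lemma norm_inv0_lt (hq0 : 0 < q0) {z : ℂ} (h : q0 < ‖z‖) : ‖inv0 q0 z‖ < q0 := by
  have : 0 < ‖z‖ := hq0.trans h
  rw [inv0, norm_div, norm_neg, norm_pow, norm_real, Real.norm_eq_abs, abs_of_pos hq0,
    div_lt_iff₀ this, sq]
  exact mul_lt_mul_of_pos_left h hq0

lemma im_inv0 (z : ℂ) : (inv0 q0 z).im = q0 ^ 2 * z.im / normSq z := by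
  rw [inv0, ← ofReal_pow, ← ofReal_neg, div_eq_mul_inv, im_ofReal_mul, inv_im]
  ring

lemma inv0_mem_D4 (hq0 : 0 < q0) {z : ℂ} (h : z ∈ D1 q0) : inv0 q0 z ∈ D4 q0 := by
  refine ⟨norm_inv0_lt hq0 h.1, ?_⟩
  have hz : z ≠ 0 := by rintro rfl; exact lt_irrefl _ h.2
  rw [im_inv0]
  exact div_pos (mul_pos (by positivity) h.2) (normSq_pos.2 hz)

lemma inv0_mem_D3 (hq0 : 0 < q0) {z : ℂ} (h : z ∈ D2 q0) : inv0 q0 z ∈ D3 q0 := by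
  refine ⟨norm_inv0_lt hq0 h.1, ?_⟩
  have hz : z ≠ 0 := by rintro rfl; exact lt_irrefl _ h.2
  rw [im_inv0]
  exact div_neg_of_neg_of_pos (mul_neg_of_pos_of_neg (by positivity) h.2) (normSq_pos.2 hz)

lemma inv0_injective (hq0 : 0 < q0) : Function.Injective (inv0 q0) := by
  intro z w h
  have hq : -((q0 : ℂ) ^ 2) ≠ 0 := neg_ne_zero.2 (pow_ne_zero _ (by exact_mod_cast hq0.ne'))
  simp only [inv0, div_eq_mul_inv] at h
  exact inv_injective (mul_left_cancel₀ hq h)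

lemma D1_subset : D1 q0 ⊆ (Sigma q0)ᶜ := Set.subset_union_left.trans (Dplus_subset q0)
lemma D2_subset : D2 q0 ⊆ (Sigma q0)ᶜ := Set.subset_union_left.trans (Dminus_subset q0)
lemma D3_subset : D3 q0 ⊆ (Sigma q0)ᶜ := Set.subset_union_right.trans (Dplus_subset q0)
lemma D4_subset : D4 q0 ⊆ (Sigma q0)ᶜ := Set.subset_union_right.trans (Dminus_subset q0)

end regions

namespace DiscreteData

variable {q0 : ℝ} {N₁ N₂ N₃ : ℕ} (S : DiscreteData q0 N₁ N₂ N₃)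

lemma z_injective : Function.Injective S.z := S.distinct.comp Sum.inl_injective
lemma ζ_injective : Function.Injective S.ζ :=
  S.distinct.comp (Sum.inr_injective.comp Sum.inl_injective)
lemma ω_injective : Function.Injective S.ω :=
  S.distinct.comp (Sum.inr_injective.comp Sum.inr_injective)
lemma z_ne_ζ (n : Fin N₁) (m : Fin N₂) : S.z n ≠ S.ζ m := fun h =>
  Sum.inl_ne_inr (S.distinct (a₁ := Sum.inl n) (a₂ := Sum.inr (Sum.inl m)) h)
lemma z_ne_ω (n : Fin N₁) (m : Fin N₃) : S.z n ≠ S.ω m := fun h =>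
  Sum.inl_ne_inr (S.distinct (a₁ := Sum.inl n) (a₂ := Sum.inr (Sum.inr m)) h)
lemma ζ_ne_ω (n : Fin N₂) (m : Fin N₃) : S.ζ n ≠ S.ω m := fun h =>
  Sum.inl_ne_inr (Sum.inr_injective
    (S.distinct (a₁ := Sum.inr (Sum.inl n)) (a₂ := Sum.inr (Sum.inr m)) h))

/-- The poles of the first column. -/
noncomputable def pole1 : Idx N₁ N₂ N₃ → ℂ :=
  Sum.elim (fun n => inv0 q0 (S.z n)) (Sum.elim (fun n => conj (S.z n))
    (Sum.elim (fun n => S.ζ n) (fun n => inv0 q0 (S.ω n))))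

/-- The poles of the second column. -/
noncomputable def pole2 : (Fin N₂ ⊕ Fin N₂) ⊕ Fin N₃ ⊕ Fin N₃ → ℂ :=
  Sum.elim (Sum.elim (fun n => conj (S.ζ n)) (fun n => inv0 q0 (conj (S.ζ n))))
    (Sum.elim (fun n => conj (S.ω n)) (fun n => inv0 q0 (conj (S.ω n))))

/-- The poles of the third column. -/
noncomputable def pole3 : Idx N₁ N₂ N₃ → ℂ :=
  Sum.elim (fun n => S.z n) (Sum.elim (fun n => inv0 q0 (conj (S.z n)))
    (Sum.elim (fun n => inv0 q0 (S.ζ n)) (fun n => S.ω n)))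

lemma range_pole1 : Set.range S.pole1 = S.poles 0 := by
  ext w
  simp only [pole1, poles, Set.Sum.elim_range, Set.mem_union, Set.mem_range, eq_comm (a := w),
    Matrix.cons_val_zero, Set.mem_ofPred_eq]
  tauto

lemma range_pole2 : Set.range S.pole2 = S.poles 1 := by
  ext w
  simp only [pole2, poles, Set.Sum.elim_range, Set.mem_union, Set.mem_range, eq_comm (a := w),
    Matrix.cons_val_one, Matrix.cons_val_zero, Set.mem_ofPred_eq]
  tauto

lemma range_pole3 : Set.range S.pole3 = S.poles 2 := by
  ext w
  simp only [pole3, poles, Set.Sum.elim_range, Set.mem_union, Set.mem_range, eq_comm (a := w),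
    Matrix.cons_val, Set.mem_ofPred_eq]



/-- Each family of poles lies in a single region, so most coincidences are excluded by disjointness.
Families sharing a region are separated by the distinctness of the eigenvalues. -/
lemma pole1_injective (hq0 : 0 < q0) : Function.Injective S.pole1 := by
  have hi := inv0_injective hq0
  refine (hi.comp S.z_injective).sumElim (((starRingEnd ℂ).injective.comp S.z_injective).sumElim
    (S.ζ_injective.sumElim (hi.comp S.ω_injective) ?_) ?_) ?_
  · exact fun n m => disjoint_D1_D4.ne_of_mem (S.ζ_mem n) (inv0_mem_D4 hq0 (S.ω_mem m))
  · rintro n (m | m)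
    · exact (disjoint_D1_D2.ne_of_mem (S.ζ_mem m) (conj_mem_D2 (S.z_mem n))).symm
    · exact disjoint_D2_D4.ne_of_mem (conj_mem_D2 (S.z_mem n)) (inv0_mem_D4 hq0 (S.ω_mem m))
  · rintro n (m | m | m)
    · exact (disjoint_D2_D4.ne_of_mem (conj_mem_D2 (S.z_mem m)) (inv0_mem_D4 hq0 (S.z_mem n))).symm
    · exact (disjoint_D1_D4.ne_of_mem (S.ζ_mem m) (inv0_mem_D4 hq0 (S.z_mem n))).symm
    · exact fun h => S.z_ne_ω n m (hi h)

lemma pole2_injective (hq0 : 0 < q0) : Function.Injective S.pole2 := by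
  have hi := inv0_injective hq0
  have hc := (starRingEnd ℂ).injective
  refine ((hc.comp S.ζ_injective).sumElim (hi.comp (hc.comp S.ζ_injective)) ?_).sumElim
    ((hc.comp S.ω_injective).sumElim (hi.comp (hc.comp S.ω_injective)) ?_) ?_
  · exact fun n m => disjoint_D2_D3.ne_of_mem (conj_mem_D2 (S.ζ_mem n))
      (inv0_mem_D3 hq0 (conj_mem_D2 (S.ζ_mem m)))
  · exact fun n m => disjoint_D2_D3.ne_of_mem (conj_mem_D2 (S.ω_mem n))
      (inv0_mem_D3 hq0 (conj_mem_D2 (S.ω_mem m)))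
  · rintro (n | n) (m | m)
    · exact fun h => S.ζ_ne_ω n m (hc h)
    · exact disjoint_D2_D3.ne_of_mem (conj_mem_D2 (S.ζ_mem n))
        (inv0_mem_D3 hq0 (conj_mem_D2 (S.ω_mem m)))
    · exact (disjoint_D2_D3.ne_of_mem (conj_mem_D2 (S.ω_mem m))
        (inv0_mem_D3 hq0 (conj_mem_D2 (S.ζ_mem n)))).symm
    · exact fun h => S.ζ_ne_ω n m (hc (hi h))

lemma pole3_injective (hq0 : 0 < q0) : Function.Injective S.pole3 := by
  have hi := inv0_injective hq0
  have hc := (starRingEnd ℂ).injective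
  refine S.z_injective.sumElim ((hi.comp (hc.comp S.z_injective)).sumElim
    ((hi.comp S.ζ_injective).sumElim S.ω_injective ?_) ?_) ?_
  · exact fun n m => (disjoint_D1_D4.ne_of_mem (S.ω_mem m) (inv0_mem_D4 hq0 (S.ζ_mem n))).symm
  · rintro n (m | m)
    · exact disjoint_D3_D4.ne_of_mem (inv0_mem_D3 hq0 (conj_mem_D2 (S.z_mem n)))
        (inv0_mem_D4 hq0 (S.ζ_mem m))
    · exact (disjoint_D1_D3.ne_of_mem (S.ω_mem m)
        (inv0_mem_D3 hq0 (conj_mem_D2 (S.z_mem n)))).symm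
  · rintro n (m | m | m)
    · exact disjoint_D1_D3.ne_of_mem (S.z_mem n) (inv0_mem_D3 hq0 (conj_mem_D2 (S.z_mem m)))
    · exact disjoint_D1_D4.ne_of_mem (S.z_mem n) (inv0_mem_D4 hq0 (S.ζ_mem m))
    · exact S.z_ne_ω n m

lemma pole1_notMem (hq0 : 0 < q0) (i : Idx N₁ N₂ N₃) : S.pole1 i ∉ Sigma q0 := by
  rcases i with n | n | n | n
  · exact D4_subset (inv0_mem_D4 hq0 (S.z_mem n))
  · exact D2_subset (conj_mem_D2 (S.z_mem n))
  · exact D1_subset (S.ζ_mem n)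
  · exact D4_subset (inv0_mem_D4 hq0 (S.ω_mem n))

lemma pole2_notMem (hq0 : 0 < q0) (i : (Fin N₂ ⊕ Fin N₂) ⊕ Fin N₃ ⊕ Fin N₃) : S.pole2 i ∉ Sigma q0 := by
  rcases i with (n | n) | n | n
  · exact D2_subset (conj_mem_D2 (S.ζ_mem n))
  · exact D3_subset (inv0_mem_D3 hq0 (conj_mem_D2 (S.ζ_mem n)))
  · exact D2_subset (conj_mem_D2 (S.ω_mem n))
  · exact D3_subset (inv0_mem_D3 hq0 (conj_mem_D2 (S.ω_mem n)))

lemma pole3_notMem (hq0 : 0 < q0) (i : Idx N₁ N₂ N₃) : S.pole3 i ∉ Sigma q0 := by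
  rcases i with n | n | n | n
  · exact D1_subset (S.z_mem n)
  · exact D3_subset (inv0_mem_D3 hq0 (conj_mem_D2 (S.z_mem n)))
  · exact D4_subset (inv0_mem_D4 hq0 (S.ζ_mem n))
  · exact D1_subset (S.ω_mem n)

/-- The linear system evaluates rational columns at eigenvalues and their conjugates; this and the
next lemmas ensure that the column in question is regular there. -/
lemma notMem_pole1_of_mem_D1 (hq0 : 0 < q0) {w : ℂ} (hw : w ∈ D1 q0) (hζ : ∀ n, w ≠ S.ζ n) :
    w ∉ Set.range S.pole1 := by
  rintro ⟨n | n | n | n, h⟩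
  · exact disjoint_D1_D4.ne_of_mem hw (inv0_mem_D4 hq0 (S.z_mem n)) h.symm
  · exact disjoint_D1_D2.ne_of_mem hw (conj_mem_D2 (S.z_mem n)) h.symm
  · exact hζ n h.symm
  · exact disjoint_D1_D4.ne_of_mem hw (inv0_mem_D4 hq0 (S.ω_mem n)) h.symm

lemma notMem_pole1_of_mem_D2 (hq0 : 0 < q0) {w : ℂ} (hw : w ∈ D2 q0) (hz : ∀ n, w ≠ conj (S.z n)) :
    w ∉ Set.range S.pole1 := by
  rintro ⟨n | n | n | n, h⟩
  · exact disjoint_D2_D4.ne_of_mem hw (inv0_mem_D4 hq0 (S.z_mem n)) h.symm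
  · exact hz n h.symm
  · exact disjoint_D1_D2.ne_of_mem (S.ζ_mem n) hw h
  · exact disjoint_D2_D4.ne_of_mem hw (inv0_mem_D4 hq0 (S.ω_mem n)) h.symm

lemma notMem_pole2_of_mem_D1 (hq0 : 0 < q0) {w : ℂ} (hw : w ∈ D1 q0) : w ∉ Set.range S.pole2 := by
  rintro ⟨(n | n) | n | n, h⟩
  · exact disjoint_D1_D2.ne_of_mem hw (conj_mem_D2 (S.ζ_mem n)) h.symm
  · exact disjoint_D1_D3.ne_of_mem hw (inv0_mem_D3 hq0 (conj_mem_D2 (S.ζ_mem n))) h.symm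
  · exact disjoint_D1_D2.ne_of_mem hw (conj_mem_D2 (S.ω_mem n)) h.symm
  · exact disjoint_D1_D3.ne_of_mem hw (inv0_mem_D3 hq0 (conj_mem_D2 (S.ω_mem n))) h.symm

lemma notMem_pole3_of_mem_D2 (hq0 : 0 < q0) {w : ℂ} (hw : w ∈ D2 q0) : w ∉ Set.range S.pole3 := by
  rintro ⟨n | n | n | n, h⟩
  · exact disjoint_D1_D2.ne_of_mem (S.z_mem n) hw h
  · exact disjoint_D2_D3.ne_of_mem hw (inv0_mem_D3 hq0 (conj_mem_D2 (S.z_mem n))) h.symm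
  · exact disjoint_D2_D4.ne_of_mem hw (inv0_mem_D4 hq0 (S.ζ_mem n)) h.symm
  · exact disjoint_D1_D2.ne_of_mem (S.ω_mem n) hw h

end DiscreteData

/-! ### The entries of the solution of the Riemann-Hilbert problem -/

section entries

variable {q0 : ℝ} {N₁ N₂ N₃ : ℕ} {qp : Fin 2 → ℂ} {S : DiscreteData q0 N₁ N₂ N₃}
  {L : ℂ → Matrix (Fin 3) (Fin 3) ℂ} {x t : ℝ} {M Mp Mm : ℂ → Matrix (Fin 3) (Fin 3) ℂ}

lemma tendsto_entry {α : Type*} {l : Filter α} {f : α → Matrix (Fin 3) (Fin 3) ℂ}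
    {A : Matrix (Fin 3) (Fin 3) ℂ} (h : Tendsto f l (𝓝 A)) (r c : Fin 3) :
    Tendsto (fun w => f w r c) l (𝓝 (A r c)) :=
  tendsto_pi_nhds.1 (tendsto_pi_nhds.1 h r) c

lemma IsRHSolution.isPiecewiseMeromorphic (h : IsRHSolution qp S L x t M Mp Mm) (r c : Fin 3)
    {ι : Type*} [Fintype ι] {p ρ : ι → ℂ} (hinj : Function.Injective p)
    (hrange : Set.range p = S.poles c) (hp : ∀ i, p i ∉ Sigma q0)
    (hres : ∀ i, Tendsto (fun w => (w - p i) * M w r c) (𝓝[≠] (p i)) (𝓝 (ρ i))) :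
    IsPiecewiseMeromorphic q0 p ρ (Minf q0 qp r c) (Mzero q0 qp r c) (fun w => M w r c)
      (fun w => Mp w r c) (fun w => Mm w r c) where
  injective := hinj
  notMem := hp
  differentiableOn := by rw [hrange]; exact h.holomorphic r c
  residue := hres
  plus := fun ξ h1 h2 h3 => tendsto_entry (h.boundary_plus ξ h1 h2 h3) r c
  minus := fun ξ h1 h2 h3 => tendsto_entry (h.boundary_minus ξ h1 h2 h3) r c
  nodes := fun ξ hξ => h.bounded_nodes ξ hξ r c
  infinity := tendsto_entry h.at_infinity r c
  zero := tendsto_entry h.at_zero r c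

/-- The residue coefficients of the first column. -/
noncomputable def DiscreteData.coeff1 (S : DiscreteData q0 N₁ N₂ N₃) (x t : ℝ) :
    Idx N₁ N₂ N₃ → ℂ :=
  Sum.elim (S.cEtilde x t) (Sum.elim (S.cEhat x t) (Sum.elim (S.cF x t) (S.cGtilde x t)))

/-- The residue coefficients of the third column. -/
noncomputable def DiscreteData.coeff3 (S : DiscreteData q0 N₁ N₂ N₃) (x t : ℝ) :
    Idx N₁ N₂ N₃ → ℂ :=
  Sum.elim (S.cE x t) (Sum.elim (S.cEcheck x t) (Sum.elim (S.cFtilde x t) (S.cG x t)))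

lemma DiscreteData.row1_eq (i : Idx N₁ N₂ N₃) (w : ℂ) :
    S.row1 x t w i = S.coeff1 x t i / (w - S.pole1 i) := by
  rcases i with n | n | n | n <;> rfl

lemma DiscreteData.row3_eq (i : Idx N₁ N₂ N₃) (w : ℂ) :
    S.row3 x t w i = S.coeff3 x t i / (w - S.pole3 i) := by
  rcases i with n | n | n | n <;> rfl

/-- The poles are listed in the order of the unknowns, so that the residue at the `i`-th pole is a
multiple of the `i`-th unknown. -/
lemma IsRHSolution.column1 (hq0 : 0 < q0) (h : IsRHSolution qp S L x t M Mp Mm) (j : Fin 2) :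
    IsPiecewiseMeromorphic q0 S.pole1 (fun i => S.coeff1 x t i * S.unknowns M j i) (qp j / q0) 0
      (fun w => M w j.castSucc 0) (fun w => Mp w j.castSucc 0) (fun w => Mm w j.castSucc 0) := by
  have h1 := h.isPiecewiseMeromorphic j.castSucc 0 (S.pole1_injective hq0) S.range_pole1
    (S.pole1_notMem hq0) (ρ := fun i => S.coeff1 x t i * S.unknowns M j i) (by
      rintro (n | n | n | n)
      · exact h.res_z_inv n j.castSucc
      · exact h.res_z_conj n j.castSucc
      · exact h.res_ζ n j.castSucc
      · exact h.res_ω_inv n j.castSucc)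
  have e1 : Minf q0 qp j.castSucc 0 = qp j / q0 := by fin_cases j <;> simp [Minf]
  have e2 : Mzero q0 qp j.castSucc 0 = 0 := by fin_cases j <;> simp [Mzero]
  rwa [e1, e2] at h1

lemma IsRHSolution.column2 (hq0 : 0 < q0) (h : IsRHSolution qp S L x t M Mp Mm) (j : Fin 2) :
    IsPiecewiseMeromorphic q0 S.pole2
      (Sum.elim
        (Sum.elim (fun n => S.cFhat x t n * M (conj (S.ζ n)) j.castSucc 0)
          (fun n => S.cFcheck x t n * M (conj (S.ζ n)) j.castSucc 0))
        (Sum.elim (fun n => S.cGhat x t n * M (conj (S.ω n)) j.castSucc 2)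
          (fun n => S.cGcheck x t n * M (conj (S.ω n)) j.castSucc 2))) (perp qp j / q0) 0
      (fun w => M w j.castSucc 1) (fun w => Mp w j.castSucc 1) (fun w => Mm w j.castSucc 1) := by
  have h1 := h.isPiecewiseMeromorphic j.castSucc 1 (S.pole2_injective hq0) S.range_pole2
    (S.pole2_notMem hq0) (ρ := Sum.elim
        (Sum.elim (fun n => S.cFhat x t n * M (conj (S.ζ n)) j.castSucc 0)
          (fun n => S.cFcheck x t n * M (conj (S.ζ n)) j.castSucc 0))
        (Sum.elim (fun n => S.cGhat x t n * M (conj (S.ω n)) j.castSucc 2)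
          (fun n => S.cGcheck x t n * M (conj (S.ω n)) j.castSucc 2))) (by
      rintro ((n | n) | n | n)
      · exact h.res_ζ_conj n j.castSucc
      · exact h.res_ζ_inv_conj n j.castSucc
      · exact h.res_ω_conj n j.castSucc
      · exact h.res_ω_inv_conj n j.castSucc)
  have e1 : Minf q0 qp j.castSucc 1 = perp qp j / q0 := by fin_cases j <;> simp [Minf]
  have e2 : Mzero q0 qp j.castSucc 1 = 0 := by fin_cases j <;> simp [Mzero]
  rwa [e1, e2] at h1

lemma IsRHSolution.column3 (hq0 : 0 < q0) (h : IsRHSolution qp S L x t M Mp Mm) (j : Fin 2) :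
    IsPiecewiseMeromorphic q0 S.pole3 (fun i => S.coeff3 x t i * S.unknowns M j i) 0 (I * qp j)
      (fun w => M w j.castSucc 2) (fun w => Mp w j.castSucc 2) (fun w => Mm w j.castSucc 2) := by
  have h1 := h.isPiecewiseMeromorphic j.castSucc 2 (S.pole3_injective hq0) S.range_pole3
    (S.pole3_notMem hq0) (ρ := fun i => S.coeff3 x t i * S.unknowns M j i) (by
      rintro (n | n | n | n)
      · exact h.res_z n j.castSucc
      · exact h.res_z_inv_conj n j.castSucc
      · exact h.res_ζ_inv n j.castSucc
      · exact h.res_ω n j.castSucc)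
  have e1 : Minf q0 qp j.castSucc 2 = 0 := by fin_cases j <;> simp [Minf]
  have e2 : Mzero q0 qp j.castSucc 2 = I * qp j := by fin_cases j <;> simp [Mzero]
  rwa [e1, e2] at h1

lemma DiscreteData.sum_coeff3 (j : Fin 2) :
    ∑ i, S.coeff3 x t i * S.unknowns M j i = S.residueSum x t M j := by
  simp only [Fintype.sum_sum_type, residueSum, coeff3, unknowns, Sum.elim_inl, Sum.elim_inr]
  ring

/-- The integral representation of the `1 / z` coefficient of the third column. -/
lemma IsRHSolution.tendsto_coeff (hq0 : 0 < q0) (h : IsRHSolution qp S L x t M Mp Mm) (j : Fin 2)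
    (hint : SigmaIntegrable q0 (fun ξ => (Mm ξ * Lhat q0 L x t ξ) j.castSucc 2)) :
    Tendsto (fun y : ℝ => (y * I : ℂ) * M (y * I) j.castSucc 2) atTop
      (𝓝 (I * qp j + S.residueSum x t M j + 1 / (2 * Real.pi * I) *
        sigmaIntegral q0 (fun ξ => (Mm ξ * Lhat q0 L x t ξ) j.castSucc 2))) := by
  have h1 := (h.column3 hq0 j).tendsto_coeff hq0 (fun ξ h1 h2 h3 => by
    rw [h.jump ξ h1 h2 h3, Matrix.mul_sub, Matrix.mul_one, Matrix.sub_apply]) hint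
  simpa only [sub_zero, DiscreteData.sum_coeff3] using h1

/-! ### The linear system of the reflectionless case -/

lemma IsRHSolution.no_jump (h : IsRHSolution qp S L x t M Mp Mm) (hL : ∀ ξ ∈ Sigma q0, L ξ = 0)
    (r c : Fin 3) : ∀ ξ ∈ Sigma q0, ξ ≠ 0 → ξ ^ 4 ≠ (q0 : ℂ) ^ 4 → Mp ξ r c = Mm ξ r c := by
  intro ξ h1 h2 h3
  rw [h.jump ξ h1 h2 h3, Lhat, hL ξ h1]
  simp

variable (hq0 : 0 < q0) (h : IsRHSolution qp S L x t M Mp Mm) (hL : ∀ ξ ∈ Sigma q0, L ξ = 0)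
  (j : Fin 2)
include hq0 h hL

lemma IsRHSolution.entry1_eq {w : ℂ} (hw : w ∉ Sigma q0) (hp : w ∉ Set.range S.pole1) :
    M w j.castSucc 0 = qp j / q0 + S.row1 x t w ⬝ᵥ S.unknowns M j := by
  have h1 := (h.column1 hq0 j).eq_rational hq0 (h.no_jump hL _ _) hw hp
  rw [h1, zero_div, add_zero, dotProduct]
  congr 1
  refine Finset.sum_congr rfl fun i _ => ?_
  rw [DiscreteData.row1_eq]; ring

lemma IsRHSolution.entry3_eq {w : ℂ} (hw : w ∉ Sigma q0) (hp : w ∉ Set.range S.pole3) :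
    M w j.castSucc 2 = I * qp j / w + S.row3 x t w ⬝ᵥ S.unknowns M j := by
  have h1 := (h.column3 hq0 j).eq_rational hq0 (h.no_jump hL _ _) hw hp
  rw [h1, zero_add, dotProduct]
  congr 1
  refine Finset.sum_congr rfl fun i _ => ?_
  rw [DiscreteData.row3_eq]; ring

/-- The residues of the second column involve `m₁(ζ_n*)` and `m₃(ω_n*)`, which are not unknowns.
Substituting the rational expressions for these values closes the system. -/
lemma IsRHSolution.entry2_eq {w : ℂ} (hw : w ∈ D1 q0) :
    M w j.castSucc 1 = S.b2 x t qp j w + S.row2 x t w ⬝ᵥ S.unknowns M j := by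
  have h1 := (h.column2 hq0 j).eq_rational hq0 (h.no_jump hL _ _) (D1_subset hw)
    (S.notMem_pole2_of_mem_D1 hq0 hw)
  have hc := (starRingEnd ℂ).injective
  have h2 : M w j.castSucc 1 = perp qp j / q0 +
      ((∑ n, S.Δ1 x t n w * M (conj (S.ζ n)) j.castSucc 0) +
        ∑ n, S.Δ2 x t n w * M (conj (S.ω n)) j.castSucc 2) := by
    rw [h1, zero_div, add_zero]
    simp only [Fintype.sum_sum_type, Sum.elim_inl, Sum.elim_inr, DiscreteData.pole2,
      ← Finset.sum_add_distrib]
    congr 2 <;>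
    · refine Finset.sum_congr rfl fun n _ => ?_
      simp only [DiscreteData.Δ1, DiscreteData.Δ2]
      ring
  have hζ : ∀ n, M (conj (S.ζ n)) j.castSucc 0 =
      qp j / q0 + S.row1 x t (conj (S.ζ n)) ⬝ᵥ S.unknowns M j := fun n =>
    h.entry1_eq hq0 hL j (D2_subset (conj_mem_D2 (S.ζ_mem n)))
      (S.notMem_pole1_of_mem_D2 hq0 (conj_mem_D2 (S.ζ_mem n)) fun m h' =>
        S.z_ne_ζ m n (hc h').symm)
  have hω : ∀ n, M (conj (S.ω n)) j.castSucc 2 =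
      I * qp j / conj (S.ω n) + S.row3 x t (conj (S.ω n)) ⬝ᵥ S.unknowns M j := fun n =>
    h.entry3_eq hq0 hL j (D2_subset (conj_mem_D2 (S.ω_mem n)))
      (S.notMem_pole3_of_mem_D2 hq0 (conj_mem_D2 (S.ω_mem n)))
  have hrow : S.row2 x t w ⬝ᵥ S.unknowns M j =
      (∑ n, S.Δ1 x t n w * (S.row1 x t (conj (S.ζ n)) ⬝ᵥ S.unknowns M j)) +
        ∑ n, S.Δ2 x t n w * (S.row3 x t (conj (S.ω n)) ⬝ᵥ S.unknowns M j) := by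
    simp only [dotProduct, DiscreteData.row2, add_mul, Finset.sum_mul, Finset.mul_sum,
      Finset.sum_add_distrib, mul_assoc]
    congr 1 <;> exact Finset.sum_comm
  simp only [hζ, hω, mul_add, Finset.sum_add_distrib] at h2
  rw [h2, hrow, DiscreteData.b2]
  ring

/-- The linear system `W x = b`. -/
theorem IsRHSolution.linear_system : S.W x t *ᵥ S.unknowns M j = S.b x t qp j := by
  rw [DiscreteData.W, Matrix.sub_mulVec, Matrix.one_mulVec, sub_eq_iff_eq_add]
  ext i
  rcases i with n | n | n | n
  · exact h.entry1_eq hq0 hL j (D1_subset (S.z_mem n))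
      (S.notMem_pole1_of_mem_D1 hq0 (S.z_mem n) fun m => S.z_ne_ζ n m)
  · exact h.entry3_eq hq0 hL j (D2_subset (conj_mem_D2 (S.z_mem n)))
      (S.notMem_pole3_of_mem_D2 hq0 (conj_mem_D2 (S.z_mem n)))
  · exact h.entry2_eq hq0 hL j (S.ζ_mem n)
  · exact h.entry2_eq hq0 hL j (S.ω_mem n)

end entries

/-! ### Determinant identities for a solvable linear system. -/

/-- Determinant of a bordered matrix, in terms of a solution of the linear system. -/
lemma det_bordered {ι : Type*} [Fintype ι] [DecidableEq ι] (W : Matrix ι ι ℂ) (a : ℂ)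
    (u y b : ι → ℂ) (hu : W *ᵥ u = b) :
    (Matrix.fromBlocks (Matrix.of fun _ _ => a) (Matrix.replicateRow Unit y)
      (Matrix.replicateCol Unit b) W).det = W.det * (a - y ⬝ᵥ u) := by
  -- A column operation: since `b = W u`, a unipotent factor on the right clears the column `b` and
  -- turns the corner into `a - y · u`.
  have hfac : Matrix.fromBlocks (Matrix.of fun _ _ => a) (Matrix.replicateRow Unit y)
      (Matrix.replicateCol Unit b) W =
      Matrix.fromBlocks (Matrix.of fun _ _ : Unit => a - y ⬝ᵥ u) (Matrix.replicateRow Unit y) 0 W *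
        Matrix.fromBlocks 1 0 (Matrix.replicateCol Unit u) 1 := by
    rw [Matrix.fromBlocks_multiply]
    congr 1
    · ext i k
      simp [Matrix.mul_apply, dotProduct]
    · simp
    · rw [Matrix.zero_mul, zero_add, ← hu]
      ext i k
      simp [Matrix.mul_apply, Matrix.mulVec, dotProduct]
    · simp
  rw [hfac, Matrix.det_mul, Matrix.det_fromBlocks_zero₂₁, Matrix.det_fromBlocks_zero₁₂]
  simp [mul_comm]

/-- Cramer's rule for a system with a given solution. -/
lemma det_updateCol_of_mulVec_eq {ι : Type*} [Fintype ι] [DecidableEq ι] {W : Matrix ι ι ℂ}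
    {u b : ι → ℂ} (hu : W *ᵥ u = b) (k : ι) : (W.updateCol k b).det = W.det * u k := by
  rw [← Matrix.cramer_apply, ← hu, Matrix.cramer_eq_adjugate_mulVec, Matrix.mulVec_mulVec,
    Matrix.adjugate_mul, Matrix.smul_mulVec, Matrix.one_mulVec, Pi.smul_apply, smul_eq_mul]

end CMKdV

/-! ### Reconstruction formula and reflectionless case. -/

theorem mainTheorem9 {N₁ N₂ N₃ : ℕ} (q0 : ℝ) (hq0 : 0 < q0) (qp : Fin 2 → ℂ)
    (hqp : ‖qp 0‖ ^ 2 + ‖qp 1‖ ^ 2 = q0 ^ 2)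
    (S : CMKdV.DiscreteData q0 N₁ N₂ N₃)
    (L : ℂ → Matrix (Fin 3) (Fin 3) ℂ)
    (M Mp Mm : ℝ → ℝ → ℂ → Matrix (Fin 3) (Fin 3) ℂ)
    (q : ℝ → ℝ → Fin 2 → ℂ)
    (hq : ∀ t, Continuous fun x => q x t)
    (hRH : ∀ x t, CMKdV.IsRHSolution qp S L x t (M x t) (Mp x t) (Mm x t))
    (hLax : CMKdV.IsPotentialOf S M q) :
    -- reconstruction of the potential from the solution of the Riemann-Hilbert problem
    (∀ (x t : ℝ) (j : Fin 2),
      CMKdV.SigmaIntegrable q0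
        (fun ξ => (Mm x t ξ * CMKdV.Lhat q0 L x t ξ) j.castSucc 2) →
      q x t j = qp j - I * S.residueSum x t (M x t) j
        - 1 / (2 * Real.pi) * CMKdV.sigmaIntegral q0
            (fun ξ => (Mm x t ξ * CMKdV.Lhat q0 L x t ξ) j.castSucc 2)) ∧
    -- the reflectionless case
    ((∀ ξ ∈ CMKdV.Sigma q0, L ξ = 0) → ∀ (x t : ℝ) (j : Fin 2),
      q x t j = qp j - I * S.residueSum x t (M x t) j ∧
      S.W x t *ᵥ S.unknowns (M x t) j = S.b x t qp j ∧
      (S.W x t).det * q x t j = (S.Waug x t qp j).det ∧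
      ((S.W x t).det ≠ 0 →
        (∀ k, S.unknowns (M x t) j k =
          ((S.W x t).updateCol k (S.b x t qp j)).det / (S.W x t).det) ∧
        q x t j = (S.Waug x t qp j).det / (S.W x t).det)) := by
  have hrec : ∀ (x t : ℝ) (j : Fin 2),
      CMKdV.SigmaIntegrable q0
        (fun ξ => (Mm x t ξ * CMKdV.Lhat q0 L x t ξ) j.castSucc 2) →
      q x t j = qp j - I * S.residueSum x t (M x t) j
        - 1 / (2 * Real.pi) * CMKdV.sigmaIntegral q0
            (fun ξ => (Mm x t ξ * CMKdV.Lhat q0 L x t ξ) j.castSucc 2) := by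
    intro x t j hint
    have h1 := hLax.tendsto hq0 hq (fun x t => (hRH x t).at_infinity) x t j
    have h2 := tendsto_nhds_unique h1 ((hRH x t).tendsto_coeff hq0 j hint)
    -- The two limits are `i q_j` and the Riemann–Hilbert coefficient; division by `i` turns
    -- `1/(2πi)` into `-1/(2π)`.
    apply mul_left_cancel₀ I_ne_zero
    rw [h2, one_div, mul_inv, inv_I]
    linear_combination S.residueSum x t (M x t) j * I_mul_I
  refine ⟨hrec, fun hL x t j => ?_⟩
  -- The factor `L` vanishes on all of `Σ`, so the arbitrary values of `Mm` at the origin and the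
  -- nodes do no harm.
  have hzero : ∀ ξ ∈ CMKdV.Sigma q0,
      (Mm x t ξ * CMKdV.Lhat q0 L x t ξ) j.castSucc 2 = 0 := by
    intro ξ hξ
    simp [CMKdV.Lhat, hL ξ hξ]
  have hq' : q x t j = qp j - I * S.residueSum x t (M x t) j := by
    have h1 := hrec x t j (by
      constructor
      · simp only [hzero _ (CMKdV.real_mem_Sigma q0 _)]; exact integrable_zero _ _ _
      · simp only [hzero _ (CMKdV.circPt_mem_Sigma hq0 _)]; exact intervalIntegrable_const)
    rw [h1]
    simp [CMKdV.sigmaIntegral, hzero _ (CMKdV.real_mem_Sigma q0 _),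
      hzero _ (CMKdV.circPt_mem_Sigma hq0 _)]
  have hsys := (hRH x t).linear_system hq0 hL j
  have hdet : (S.W x t).det * q x t j = (S.Waug x t qp j).det := by
    have hy : S.y x t ⬝ᵥ S.unknowns (M x t) j = I * S.residueSum x t (M x t) j := by
      rw [← CMKdV.DiscreteData.sum_coeff3, Finset.mul_sum]
      refine Finset.sum_congr rfl fun i _ => ?_
      rw [← mul_assoc]
      rcases i with n | n | n | n <;> rfl
    rw [CMKdV.DiscreteData.Waug, CMKdV.det_bordered _ _ _ _ _ hsys, hy, hq']
  refine ⟨hq', hsys, hdet, fun hW => ⟨fun k => ?_, ?_⟩⟩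
  · rw [CMKdV.det_updateCol_of_mulVec_eq hsys k, mul_div_cancel_left₀ _ hW]
  · rw [← hdet, mul_div_cancel_left₀ _ hW]
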